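/- For $k>0$ and $x,y\in\mathbb R^3$, $x\ne y$, let $\Phi_k(x,y)=\dfrac{e^{\mathrm i k|x-y|}}{4\pi|x-y|}$ be the outgoing fundamental solution of $-\Delta-k^2$, and let $$(\mathcal R_k\varphi)(x)=\int_{\mathbb R^3}\Phi_k(x,y)\,\varphi(y)\,dy$$ for functions $\varphi$ for which this integral is well-defined (absolutely convergent) for almost every $x\in\mathbb R^3$. For $s,\delta\in\mathbb R$, with $\langle x\rangle=(1+|x|^2)^{1/2}$, let $$\|f\|_{H^s_\delta(\mathbb R^3)}=\|\langle\cdot\rangle^{\delta}(I-\Delta)^{s/2}f\|_{L^2(\mathbb R^3)},\qquad H^s_\delta(\mathbb R^3)=\{f\in\mathscr S'(\mathbb R^3):\ \|f\|_{H^s_\delta(\mathbb R^3)}<\infty\}.$$ Let $0<s<1/2$ and $\epsilon>0$. Then there is a constant $C_{\epsilon,s}>0$, depending only on $\epsilon$ and $s$, such that for every $k>2$ there is exactly one bounded linear operator from $H^{-s}_{1/2+\epsilon}(\mathbb R^3)$ to $H^{s}_{-1/2-\epsilon}(\mathbb R^3)$ which coincides with the integral operator $\mathcal R_k$ on every function in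 $H^{-s}_{1/2+\epsilon}(\mathbb R^3)$ for which the integral is well-defined almost everywhere; and this operator, again denoted by $\mathcal R_k$, satisfies $$\|\mathcal R_k\varphi\|_{H^{s}_{-1/2-\epsilon}(\mathbb R^3)}\le C_{\epsilon,s}\,k^{-(1-2s)}\,\|\varphi\|_{H^{-s}_{1/2+\epsilon}(\mathbb R^3)}\qquad\text{for all }\varphi\in H^{-s}_{1/2+\epsilon}(\mathbb R^3).$$ -/

import Mathlib

open MeasureTheory TemperedDistribution
open scoped SchwartzMap

noncomputable section

/-- Three-dimensional Euclidean space. -/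
abbrev R3 : Type := EuclideanSpace ℝ (Fin 3)

/-- The power `⟨x⟩ ^ δ` of the Japanese bracket `⟨x⟩ = (1 + |x|²)^(1/2)`. -/
def bracketPow (δ : ℝ) (x : R3) : ℂ := (((1 + ‖x‖ ^ 2) ^ (δ / 2) : ℝ) : ℂ)

theorem bracketPow_hasTemperateGrowth (δ : ℝ) : (bracketPow δ).HasTemperateGrowth := by
  unfold bracketPow
  fun_prop

theorem bracketPow_mul_neg (δ : ℝ) (x : R3) : bracketPow δ x * bracketPow (-δ) x = 1 := by
  unfold bracketPow
  rw [← Complex.ofReal_mul, ← Real.rpow_add (by positivity)]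
  simp [neg_div]

/-- The Fourier symbol of `(I - Δ)^(s/2)`. The Fourier transform of Mathlib is
`∫ e^(-2πi x·ξ) φ(x) dx`, under which `-Δ` has the symbol `|2πξ|²`. -/
def laplaceSymbol (s : ℝ) (ξ : R3) : ℂ := bracketPow s ((2 * Real.pi) • ξ)

theorem laplaceSymbol_hasTemperateGrowth (s : ℝ) : (laplaceSymbol s).HasTemperateGrowth := by
  have h : (fun ξ : R3 => (2 * Real.pi) • ξ).HasTemperateGrowth := by fun_prop
  exact (bracketPow_hasTemperateGrowth s).comp h

/-- The operator `(I - Δ)^(s/2)` on tempered distributions on `ℝ³`. -/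
def fracBessel (s : ℝ) : 𝓢'(R3, ℂ) →L[ℂ] 𝓢'(R3, ℂ) :=
  fourierMultiplierCLM ℂ (laplaceSymbol s)

/-- The operator `f ↦ ⟨x⟩^δ (I - Δ)^(s/2) f` on tempered distributions on `ℝ³`. -/
def weightedBessel (s δ : ℝ) : 𝓢'(R3, ℂ) →L[ℂ] 𝓢'(R3, ℂ) :=
  smulLeftCLM ℂ (bracketPow δ) ∘L fracBessel s

theorem weightedBessel_injective (s δ : ℝ) : Function.Injective (weightedBessel s δ) := by
  have h1 : Function.LeftInverse (smulLeftCLM ℂ (bracketPow (-δ)))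
      (smulLeftCLM ℂ (bracketPow δ) : 𝓢'(R3, ℂ) →L[ℂ] 𝓢'(R3, ℂ)) := by
    intro f
    rw [smulLeftCLM_smulLeftCLM_apply (bracketPow_hasTemperateGrowth _)
      (bracketPow_hasTemperateGrowth _)]
    have : bracketPow δ * bracketPow (-δ) = fun _ : R3 => (1 : ℂ) :=
      funext (bracketPow_mul_neg δ)
    rw [this]
    simp
  have h2 : Function.LeftInverse (fracBessel (-s)) (fracBessel s) := by
    intro f
    unfold fracBessel
    rw [fourierMultiplierCLM_fourierMultiplierCLM_apply (laplaceSymbol_hasTemperateGrowth _)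
      (laplaceSymbol_hasTemperateGrowth _)]
    have : laplaceSymbol s * laplaceSymbol (-s) = fun _ : R3 => (1 : ℂ) :=
      funext fun ξ => bracketPow_mul_neg s _
    rw [this]
    simp
  exact h1.injective.comp h2.injective

/-- The weighted Sobolev space `H^s_δ(ℝ³)`: all tempered distributions `f` such that
`⟨x⟩^δ (I - Δ)^(s/2) f` belongs to `L²(ℝ³)`. It carries the norm
`‖f‖ = ‖⟨x⟩^δ (I - Δ)^(s/2) f‖_{L²}`. -/
structure WeightedSobolev (s δ : ℝ) where
  toDistribution : 𝓢'(R3, ℂ)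
  mem : ∃ g : Lp ℂ 2 (volume : Measure R3), weightedBessel s δ toDistribution = g

namespace WeightedSobolev

variable {s δ : ℝ}

theorem toDistribution_injective :
    Function.Injective (toDistribution : WeightedSobolev s δ → 𝓢'(R3, ℂ)) := by
  rintro ⟨f, hf⟩ ⟨g, hg⟩ h
  cases h
  rfl

instance : Zero (WeightedSobolev s δ) where
  zero := ⟨0, 0, by rw [← Lp.toTemperedDistributionCLM_apply, map_zero, map_zero]⟩

instance : Add (WeightedSobolev s δ) where
  add f g := ⟨f.toDistribution + g.toDistribution, by
    obtain ⟨a, ha⟩ := f.mem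
    obtain ⟨b, hb⟩ := g.mem
    refine ⟨a + b, ?_⟩
    rw [map_add, ha, hb]
    exact (map_add (Lp.toTemperedDistributionCLM ℂ volume 2) a b).symm⟩

instance : Neg (WeightedSobolev s δ) where
  neg f := ⟨-f.toDistribution, by
    obtain ⟨a, ha⟩ := f.mem
    refine ⟨-a, ?_⟩
    rw [map_neg, ha]
    exact (map_neg (Lp.toTemperedDistributionCLM ℂ volume 2) a).symm⟩

instance : Sub (WeightedSobolev s δ) where
  sub f g := ⟨f.toDistribution - g.toDistribution, by
    obtain ⟨a, ha⟩ := f.mem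
    obtain ⟨b, hb⟩ := g.mem
    refine ⟨a - b, ?_⟩
    rw [map_sub, ha, hb]
    exact (map_sub (Lp.toTemperedDistributionCLM ℂ volume 2) a b).symm⟩

theorem smul_mem {R : Type*} [SMul R ℂ] [SMul R 𝓢'(R3, ℂ)] [IsScalarTower R ℂ 𝓢'(R3, ℂ)]
    (c : R) (f : WeightedSobolev s δ) :
    ∃ g : Lp ℂ 2 (volume : Measure R3), weightedBessel s δ (c • f.toDistribution) = g := by
  obtain ⟨a, ha⟩ := f.mem
  refine ⟨(c • (1 : ℂ)) • a, ?_⟩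
  rw [← one_smul ℂ f.toDistribution, ← smul_assoc, map_smul, ha]
  exact (map_smul (Lp.toTemperedDistributionCLM ℂ volume 2) _ a).symm

instance : SMul ℕ (WeightedSobolev s δ) where
  smul c f := ⟨c • f.toDistribution, smul_mem c f⟩

instance : SMul ℤ (WeightedSobolev s δ) where
  smul c f := ⟨c • f.toDistribution, smul_mem c f⟩

instance : SMul ℂ (WeightedSobolev s δ) where
  smul c f := ⟨c • f.toDistribution, smul_mem c f⟩

instance : AddCommGroup (WeightedSobolev s δ) :=
  toDistribution_injective.addCommGroup _ rfl (fun _ _ => rfl) (fun _ => rfl) (fun _ _ => rfl)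
    (fun _ _ => rfl) (fun _ _ => rfl)

/-- The inclusion of `H^s_δ(ℝ³)` into the tempered distributions, as an additive map. -/
def toDistributionHom : WeightedSobolev s δ →+ 𝓢'(R3, ℂ) where
  toFun := toDistribution
  map_zero' := rfl
  map_add' _ _ := rfl

instance : Module ℂ (WeightedSobolev s δ) :=
  toDistribution_injective.module ℂ toDistributionHom (fun _ _ => rfl)

/-- The function `⟨x⟩^δ (I - Δ)^(s/2) f` as an element of `L²(ℝ³)`. -/
def repr (f : WeightedSobolev s δ) : Lp ℂ 2 (volume : Measure R3) := f.mem.choose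

theorem repr_spec (f : WeightedSobolev s δ) :
    weightedBessel s δ f.toDistribution = (f.repr : 𝓢'(R3, ℂ)) := f.mem.choose_spec

theorem lp_toDistribution_injective : Function.Injective
    (Lp.toTemperedDistributionCLM ℂ (volume : Measure R3) 2) :=
  LinearMap.ker_eq_bot.mp Lp.ker_toTemperedDistributionCLM_eq_bot

/-- `f ↦ ⟨x⟩^δ (I - Δ)^(s/2) f` as a linear map from `H^s_δ(ℝ³)` to `L²(ℝ³)`. -/
def reprHom : WeightedSobolev s δ →ₗ[ℂ] Lp ℂ 2 (volume : Measure R3) where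
  toFun := repr
  map_add' f g := by
    apply lp_toDistribution_injective
    rw [map_add]
    simp only [Lp.toTemperedDistributionCLM_apply, ← repr_spec]
    exact map_add (weightedBessel s δ) _ _
  map_smul' c f := by
    apply lp_toDistribution_injective
    rw [map_smul]
    simp only [Lp.toTemperedDistributionCLM_apply, ← repr_spec]
    exact map_smul (weightedBessel s δ) _ _

theorem reprHom_injective : Function.Injective (reprHom : WeightedSobolev s δ →ₗ[ℂ] _) := by
  intro f g h
  apply toDistribution_injective
  apply weightedBessel_injective s δ
  rw [repr_spec, repr_spec]
  exact congrArg _ h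

instance : NormedAddCommGroup (WeightedSobolev s δ) :=
  NormedAddCommGroup.induced _ _ reprHom reprHom_injective

instance : NormedSpace ℂ (WeightedSobolev s δ) :=
  NormedSpace.induced ℂ _ _ reprHom

theorem norm_def (f : WeightedSobolev s δ) : ‖f‖ = ‖f.repr‖ := rfl

end WeightedSobolev

/-- The outgoing fundamental solution `Φ_k(x, y) = e^(ik|x-y|) / (4π|x-y|)` of `-Δ - k²`. -/
def outgoingKernel (k : ℝ) (x y : R3) : ℂ :=
  Complex.exp (Complex.I * k * ‖x - y‖) / (4 * Real.pi * ‖x - y‖)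

/-- The integral `∫ Φ_k(x, y) φ(y) dy`. -/
def resolventIntegral (k : ℝ) (φ : R3 → ℂ) (x : R3) : ℂ :=
  ∫ y, outgoingKernel k x y * φ y

/-- The integral `∫ Φ_k(x, y) φ(y) dy` converges absolutely for almost every `x`. -/
def ResolventIntegrable (k : ℝ) (φ : R3 → ℂ) : Prop :=
  ∀ᵐ x : R3, Integrable (fun y => outgoingKernel k x y * φ y)

/-- The tempered distribution `u` is the function `f`. -/
def IsGivenBy (u : 𝓢'(R3, ℂ)) (f : R3 → ℂ) : Prop :=
  ∀ ψ : 𝓢(R3, ℂ), Integrable (fun x => ψ x * f x) ∧ u ψ = ∫ x, ψ x * f x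

/-- A bounded operator `T : H^s_δ → H^t_γ` extends the resolvent `R_k`: on every function `f`
in `H^s_δ` for which `∫ Φ_k(x, y) f(y) dy` is well-defined for almost every `x`, it is given
by that integral. -/
def ExtendsResolvent (k : ℝ) {s δ t γ : ℝ}
    (T : WeightedSobolev s δ →L[ℂ] WeightedSobolev t γ) : Prop :=
  ∀ (φ : WeightedSobolev s δ) (f : R3 → ℂ), IsGivenBy φ.toDistribution f →
    ResolventIntegrable k f → IsGivenBy (T φ).toDistribution (resolventIntegral k f)

end

noncomputable section

open LineDeriv Laplacian FourierTransform Filter Topology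

/-! The bound is proved for `(-Δ - z²)⁻¹` with `z = k + iη`, `0 < η ≤ 1`, on Schwartz functions,
uniformly in `η`; then `η → 0`.

Weighted `L²` bound (`helmholtz_weighted_estimate`). Multiply `(-Δ - z²)u = f` by `F·∇ū + ½(div F)ū`
with `F = x(2⟨x⟩⁻¹ - ⟨x⟩^(-1-e))`. This field is bounded, the quadratic form of its derivative is at
least `e⟨x⟩^(-1-e)`, and `Δ div F ≤ 0`. Hence the weighted norm of `∇u` is controlled by `f`, by
small multiples of `u`, and by an error carrying the factor `Im z²`. That error is harmless because
the imaginary part of `∫ f ū` is `-Im z² ∫|u|²`. The energy identity with weight `⟨x⟩^(-1-e)`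
converts control of `∇u` into control of `k u`, so `k‖u‖ ≤ C‖f‖` in the dual weighted spaces.

Gain of derivatives (`l2norm_sandwich_le`). In `(1+|ξ|²)^s / (|ξ|² - z²)`, replace the numerator by
the constant `(1+k²)^s`. The difference vanishes where `|ξ| = k`, so it divides out the
near-singularity and leaves a multiplier of size `O(k^(2s-2))`. The constant times the weighted
bound has size `k^(2s)·k⁻¹`, which is the claimed power.

Passage to the limit. The sandwiched operators are uniformly bounded on `L²`, so they have a weak
limit (`exists_weak_limit_operator`). Green's formula (`green_representation`) identifies the
approximating resolvents with integral operators of kernel `e^(iz|x-y|)/(4π|x-y|)`. Dominated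
convergence and Fubini then show that the limit operator is given by the outgoing integral whenever
that integral converges (`tendsto_integral_resolventS_mul`, `integral_mul_resolventIntegral`).
Uniqueness holds because the elements given by Schwartz functions include a dense set, and on them
the integral always converges. -/

/-! ### Bilinear weighted integrals of Schwartz functions and the multiplier identities. -/

/-- The `j`-th standard unit vector of `ℝ³`. -/
def unitVec (j : Fin 3) : R3 := EuclideanSpace.basisFun (Fin 3) ℝ j

/-- The partial derivative of a Schwartz function. -/
def partialD (j : Fin 3) (u : 𝓢(R3, ℂ)) : 𝓢(R3, ℂ) := ∂_{unitVec j} u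

theorem laplacian_eq_sum_partialD (u : 𝓢(R3, ℂ)) :
    Δ u = ∑ j, partialD j (partialD j u) :=
  SchwartzMap.laplacian_eq_sum (EuclideanSpace.basisFun (Fin 3) ℝ) u

theorem partialD_comm (i j : Fin 3) (u : 𝓢(R3, ℂ)) :
    partialD i (partialD j u) = partialD j (partialD i u) := by
  ext x
  have h := ((u.smooth 2).contDiffAt (x := x)).isSymmSndFDerivAt (by simp)
  have key : ∀ a b : Fin 3, partialD a (partialD b u) x
      = fderiv ℝ (fderiv ℝ u) x (unitVec a) (unitVec b) := by
    intro a b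
    have h1 : (partialD b u : R3 → ℂ) = fun y => fderiv ℝ u y (unitVec b) := by
      ext y; exact SchwartzMap.lineDerivOp_apply_eq_fderiv _ _ _
    have h2 : DifferentiableAt ℝ (fderiv ℝ u) x :=
      (((u.smooth 2).fderiv_right (m := 1) (by norm_num)).differentiable (by simp)) x
    unfold partialD at h1 ⊢
    rw [SchwartzMap.lineDerivOp_apply_eq_fderiv, h1]
    rw [fderiv_clm_apply h2 (by fun_prop)]
    simp
  rw [key, key, h.eq]

theorem hasLineDerivAt_schwartz (u : 𝓢(R3, ℂ)) (x : R3) (j : Fin 3) :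
    HasLineDerivAt ℝ u (partialD j u x) x (unitVec j) := by
  unfold partialD
  rw [SchwartzMap.lineDerivOp_apply_eq_fderiv]
  exact (u.hasFDerivAt x).hasLineDerivAt _

/-- The complex conjugate of a Schwartz function. -/
def conjS (u : 𝓢(R3, ℂ)) : 𝓢(R3, ℂ) :=
  u.postcompCLM (Complex.conjCLE : ℂ →L[ℝ] ℂ)

@[simp] theorem conjS_apply (u : 𝓢(R3, ℂ)) (x : R3) : conjS u x = (starRingEnd ℂ) (u x) := rfl

theorem partialD_conjS (j : Fin 3) (u : 𝓢(R3, ℂ)) :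
    partialD j (conjS u) = conjS (partialD j u) := by
  ext x
  have h1 := hasLineDerivAt_schwartz (conjS u) x j
  have h2 : HasLineDerivAt ℝ (conjS u) (conjS (partialD j u) x) x (unitVec j) := by
    have := hasLineDerivAt_schwartz u x j
    unfold HasLineDerivAt at this ⊢
    exact ((Complex.conjCLE : ℂ →L[ℝ] ℂ).hasFDerivAt.comp_hasDerivAt (0:ℝ) this)
  exact h1.unique h2

/-- The integral `∫ W a b` of two Schwartz functions against a real weight. -/
def weightedInt (W : R3 → ℝ) (a b : 𝓢(R3, ℂ)) : ℂ := ∫ x, (W x : ℂ) * a x * b x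

theorem integrable_weight_mul_mul {W : R3 → ℝ} (hW : W.HasTemperateGrowth) (a b : 𝓢(R3, ℂ)) :
    Integrable (fun x => (W x : ℂ) * a x * b x) := by
  have h := (SchwartzMap.pairing (ContinuousLinearMap.mul ℂ ℂ)
    (SchwartzMap.smulLeftCLM ℂ W a) b).integrable (μ := volume)
  refine h.congr (Filter.Eventually.of_forall fun x => ?_)
  simp [SchwartzMap.smulLeftCLM_apply_apply hW]

theorem weightedInt_symm (W : R3 → ℝ) (a b : 𝓢(R3, ℂ)) :
    weightedInt W a b = weightedInt W b a := by
  unfold weightedInt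
  congr 1; ext x; ring

theorem weightedInt_add_left {W : R3 → ℝ} (hW : W.HasTemperateGrowth) (a a' b : 𝓢(R3, ℂ)) :
    weightedInt W (a + a') b = weightedInt W a b + weightedInt W a' b := by
  unfold weightedInt
  rw [← integral_add (integrable_weight_mul_mul hW _ _) (integrable_weight_mul_mul hW _ _)]
  congr 1; ext x; simp; ring

theorem weightedInt_smul_left (W : R3 → ℝ) (c : ℂ) (a b : 𝓢(R3, ℂ)) :
    weightedInt W (c • a) b = c * weightedInt W a b := by
  unfold weightedInt
  rw [← integral_const_mul]
  congr 1; ext x; simp; ring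

theorem weightedInt_neg_left (W : R3 → ℝ) (a b : 𝓢(R3, ℂ)) :
    weightedInt W (-a) b = - weightedInt W a b := by
  unfold weightedInt
  rw [← integral_neg]
  congr 1; ext x; simp

theorem weightedInt_sum_left {W : R3 → ℝ} (hW : W.HasTemperateGrowth) (a : Fin 3 → 𝓢(R3, ℂ))
    (b : 𝓢(R3, ℂ)) : weightedInt W (∑ i, a i) b = ∑ i, weightedInt W (a i) b := by
  simp only [Fin.sum_univ_three, weightedInt_add_left hW]

theorem conj_weightedInt (W : R3 → ℝ) (a b : 𝓢(R3, ℂ)) :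
    (starRingEnd ℂ) (weightedInt W a b) = weightedInt W (conjS a) (conjS b) := by
  unfold weightedInt
  rw [← integral_conj]
  congr 1; ext x; simp

theorem conjS_conjS (u : 𝓢(R3, ℂ)) : conjS (conjS u) = u := by
  ext x; simp

/-- Integration by parts against a weight. -/
theorem weightedInt_partialD {W W' : R3 → ℝ} (hW : W.HasTemperateGrowth)
    (hW' : W'.HasTemperateGrowth) {j : Fin 3}
    (h : ∀ x, HasLineDerivAt ℝ W (W' x) x (unitVec j)) (a b : 𝓢(R3, ℂ)) :
    weightedInt W (partialD j a) b + weightedInt W a (partialD j b) + weightedInt W' a b = 0 := by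
  have key := SchwartzMap.integral_mul_lineDerivOp_right_eq_neg_left (μ := volume)
    (SchwartzMap.smulLeftCLM ℂ W a) b (unitVec j)
  have hd : ∀ x, (∂_{unitVec j} (SchwartzMap.smulLeftCLM ℂ W a)) x
      = (W' x : ℂ) * a x + W x * partialD j a x := by
    intro x
    have h1 := hasLineDerivAt_schwartz (SchwartzMap.smulLeftCLM ℂ W a) x j
    have h2 : HasLineDerivAt ℝ (SchwartzMap.smulLeftCLM ℂ W a)
        ((W' x : ℂ) * a x + W x * partialD j a x) x (unitVec j) := by
      rw [SchwartzMap.smulLeftCLM_apply hW]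
      have ha := hasLineDerivAt_schwartz a x j
      have hw := h x
      unfold HasLineDerivAt at ha hw ⊢
      convert! hw.smul ha using 1
      simp [add_comm]
    exact h1.unique h2
  simp only [hd, SchwartzMap.smulLeftCLM_apply_apply hW] at key
  have e1 : ∫ x, ((W' x : ℂ) * a x + W x * partialD j a x) * b x
      = weightedInt W' a b + weightedInt W (partialD j a) b := by
    unfold weightedInt
    rw [← integral_add (integrable_weight_mul_mul hW' _ _) (integrable_weight_mul_mul hW _ _)]
    congr 1; ext x; ring
  have e2 : ∫ x, W x • a x * (∂_{unitVec j} b) x = weightedInt W a (partialD j b) := rfl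
  rw [e1, e2] at key
  rw [key]; ring

/-- This is `∫ w Δ(uv) = ∫ (Δw) uv` with the product rule expanded. The form is bilinear; conjugates
enter later through `v = ū`. -/
theorem energy_identity {w : R3 → ℝ} {w1 w2 : Fin 3 → R3 → ℝ} (hw : w.HasTemperateGrowth)
    (hw1 : ∀ i, (w1 i).HasTemperateGrowth) (hw2 : ∀ i, (w2 i).HasTemperateGrowth)
    (h1 : ∀ i x, HasLineDerivAt ℝ w (w1 i x) x (unitVec i))
    (h2 : ∀ i x, HasLineDerivAt ℝ (w1 i) (w2 i x) x (unitVec i)) (u v : 𝓢(R3, ℂ)) :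
    weightedInt w (Δ u) v + weightedInt w (Δ v) u =
      -2 * ∑ i, weightedInt w (partialD i u) (partialD i v) + ∑ i, weightedInt (w2 i) u v := by
  simp only [laplacian_eq_sum_partialD, weightedInt_sum_left hw]
  rw [Finset.mul_sum, ← Finset.sum_add_distrib, ← Finset.sum_add_distrib]
  refine Finset.sum_congr rfl fun i _ => ?_
  have a := weightedInt_partialD hw (hw1 i) (h1 i) (partialD i u) v
  have b := weightedInt_partialD hw (hw1 i) (h1 i) (partialD i v) u
  have c := weightedInt_partialD (hw1 i) (hw2 i) (h2 i) u v
  rw [weightedInt_symm w (partialD i v) (partialD i u)] at b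
  rw [weightedInt_symm (w1 i) u (partialD i v)] at c
  linear_combination a + b - c

/-- A Rellich-Pohozaev identity. After one integration by parts the second derivatives combine, by
symmetry in `u` and `v`, into `F_j ∂_j(∂_i u ∂_i v)`, and a second integration by parts removes
them. -/
theorem momentum_identity {F : Fin 3 → R3 → ℝ} {F' : Fin 3 → Fin 3 → R3 → ℝ}
    (hF : ∀ j, (F j).HasTemperateGrowth) (hF' : ∀ i j, (F' i j).HasTemperateGrowth)
    (h : ∀ i j x, HasLineDerivAt ℝ (F j) (F' i j x) x (unitVec i)) (u v : 𝓢(R3, ℂ)) :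
    ∑ j, (weightedInt (F j) (Δ u) (partialD j v) + weightedInt (F j) (Δ v) (partialD j u)) =
      ∑ j, ∑ i, (weightedInt (F' j j) (partialD i u) (partialD i v)
        - weightedInt (F' i j) (partialD i u) (partialD j v)
        - weightedInt (F' i j) (partialD i v) (partialD j u)) := by
  refine Finset.sum_congr rfl fun j _ => ?_
  simp only [laplacian_eq_sum_partialD, weightedInt_sum_left (hF j)]
  rw [← Finset.sum_add_distrib]
  refine Finset.sum_congr rfl fun i _ => ?_
  have a := weightedInt_partialD (hF j) (hF' i j) (h i j) (partialD i u) (partialD j v)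
  have b := weightedInt_partialD (hF j) (hF' i j) (h i j) (partialD i v) (partialD j u)
  have c := weightedInt_partialD (hF j) (hF' j j) (h j j) (partialD i u) (partialD i v)
  rw [partialD_comm i j v] at a
  rw [partialD_comm i j u, weightedInt_symm _ (partialD i v) (partialD j (partialD i u))] at b
  linear_combination a + b - c

/-- The zeroth-order companion of `momentum_identity`: integrate `F·∇(uv)` by parts. It handles the
`z²` term of the Helmholtz operator. -/
theorem transport_identity {F : Fin 3 → R3 → ℝ} {F' : Fin 3 → Fin 3 → R3 → ℝ}
    (hF : ∀ j, (F j).HasTemperateGrowth) (hF' : ∀ i j, (F' i j).HasTemperateGrowth)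
    (h : ∀ i j x, HasLineDerivAt ℝ (F j) (F' i j x) x (unitVec i)) (u v : 𝓢(R3, ℂ)) :
    ∑ j, weightedInt (F j) u (partialD j v) + ∑ j, weightedInt (F j) v (partialD j u) =
      - ∑ j, weightedInt (F' j j) u v := by
  rw [← Finset.sum_add_distrib, ← Finset.sum_neg_distrib]
  refine Finset.sum_congr rfl fun j _ => ?_
  have c := weightedInt_partialD (hF j) (hF' j j) (h j j) u v
  rw [weightedInt_symm (F j) v (partialD j u)]
  linear_combination c

/-! ### Powers of the Japanese bracket, radial derivatives and weighted square integrals. -/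

/-- The real-valued power `⟨x⟩ ^ p` of the Japanese bracket. -/
def jb (p : ℝ) (x : R3) : ℝ := (1 + ‖x‖ ^ 2) ^ (p / 2)

theorem jb_pos (p : ℝ) (x : R3) : 0 < jb p x := by unfold jb; positivity

theorem jb_zero (x : R3) : jb 0 x = 1 := by simp [jb]

theorem jb_two (x : R3) : jb 2 x = 1 + ‖x‖ ^ 2 := by simp [jb]

theorem jb_add (p p' : ℝ) (x : R3) : jb (p + p') x = jb p x * jb p' x := by
  unfold jb; rw [← Real.rpow_add (by positivity)]; congr 1; ring

theorem jb_mul_neg (p : ℝ) (x : R3) : jb p x * jb (-p) x = 1 := by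
  rw [← jb_add]; simp [jb_zero]

theorem jb_mono {p p' : ℝ} (h : p ≤ p') (x : R3) : jb p x ≤ jb p' x := by
  unfold jb
  exact Real.rpow_le_rpow_of_exponent_le (by nlinarith [sq_nonneg ‖x‖]) (by linarith)

theorem jb_le_one {p : ℝ} (h : p ≤ 0) (x : R3) : jb p x ≤ 1 := by
  rw [← jb_zero x]; exact jb_mono h x

@[fun_prop]
theorem jb_hasTemperateGrowth (p : ℝ) : (jb p).HasTemperateGrowth := by
  unfold jb; fun_prop

@[fun_prop]
theorem coord_hasTemperateGrowth (j : Fin 3) : (fun x : R3 => x j).HasTemperateGrowth :=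
  (EuclideanSpace.proj j : R3 →L[ℝ] ℝ).hasTemperateGrowth

theorem norm_sq_eq_sum (x : R3) : ‖x‖ ^ 2 = x 0 ^ 2 + x 1 ^ 2 + x 2 ^ 2 := by
  rw [EuclideanSpace.norm_sq_eq, Fin.sum_univ_three]; simp

theorem hasLineDerivAt_coord (i j : Fin 3) (x : R3) :
    HasLineDerivAt ℝ (fun x : R3 => x j) (if i = j then 1 else 0) x (unitVec i) := by
  have := ((EuclideanSpace.proj j : R3 →L[ℝ] ℝ).hasFDerivAt (x := x)).hasLineDerivAt (unitVec i)
  convert! this using 1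
  simp [unitVec, eq_comm]

/-- `g` has the partial derivatives `x_i g'(x)`. -/
def HasRadialDeriv (g g' : R3 → ℝ) : Prop :=
  ∀ i x, HasLineDerivAt ℝ g (x i * g' x) x (unitVec i)

theorem hasRadialDeriv_jb (p : ℝ) : HasRadialDeriv (jb p) (fun x => p * jb (p - 2) x) := by
  intro i x
  have h1 : HasFDerivAt (fun x : R3 => 1 + ‖x‖ ^ 2) (2 • (innerSL ℝ x)) x :=
    (hasStrictFDerivAt_norm_sq x).hasFDerivAt.const_add 1
  have h2 := (h1.rpow_const (p := p / 2) (Or.inl (by positivity))).hasLineDerivAt (unitVec i)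
  convert! h2 using 1
  simp [jb, unitVec, EuclideanSpace.inner_single_right]
  ring_nf

theorem HasRadialDeriv.add {g g' h h' : R3 → ℝ} (hg : HasRadialDeriv g g')
    (hh : HasRadialDeriv h h') : HasRadialDeriv (fun x => g x + h x) (fun x => g' x + h' x) := by
  intro i x
  have a := hg i x
  have b := hh i x
  unfold HasLineDerivAt at *
  convert! a.add b using 1; ring

theorem HasRadialDeriv.const_mul {g g' : R3 → ℝ} (c : ℝ) (hg : HasRadialDeriv g g') :
    HasRadialDeriv (fun x => c * g x) (fun x => c * g' x) := by
  intro i x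
  have a := hg i x
  unfold HasLineDerivAt at *
  convert! a.const_mul c using 1; ring

theorem HasRadialDeriv.coord_mul {g g' : R3 → ℝ} (hg : HasRadialDeriv g g') (i j : Fin 3) (x : R3) :
    HasLineDerivAt ℝ (fun x => x j * g x)
      ((if i = j then 1 else 0) * g x + x j * x i * g' x) x (unitVec i) := by
  have a := hg i x
  have b := hasLineDerivAt_coord i j x
  unfold HasLineDerivAt at *
  convert! b.mul a using 1; simp; ring

/-- The weighted square integral `∫ w |a|²`. -/
def sqInt (w : R3 → ℝ) (a : 𝓢(R3, ℂ)) : ℝ := ∫ x, w x * ‖a x‖ ^ 2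

theorem mul_conj_eq (w : ℝ) (c : ℂ) :
    (w : ℂ) * c * (starRingEnd ℂ) c = ((w * ‖c‖ ^ 2 : ℝ) : ℂ) := by
  rw [mul_assoc, Complex.mul_conj, Complex.normSq_eq_norm_sq]; push_cast; ring

theorem weightedInt_conjS_self (w : R3 → ℝ) (a : 𝓢(R3, ℂ)) :
    weightedInt w a (conjS a) = (sqInt w a : ℂ) := by
  unfold weightedInt sqInt
  rw [← integral_complex_ofReal]
  congr 1; ext x; simp only [conjS_apply, mul_conj_eq]

theorem integrable_sq {w : R3 → ℝ} (hw : w.HasTemperateGrowth) (a : 𝓢(R3, ℂ)) :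
    Integrable (fun x => w x * ‖a x‖ ^ 2) := by
  have := (integrable_weight_mul_mul hw a (conjS a)).re
  refine this.congr (Filter.Eventually.of_forall fun x => ?_)
  simp only [conjS_apply, mul_conj_eq]
  exact Complex.ofReal_re _

theorem sqInt_nonneg {w : R3 → ℝ} (hw : ∀ x, 0 ≤ w x) (a : 𝓢(R3, ℂ)) : 0 ≤ sqInt w a :=
  integral_nonneg fun x => mul_nonneg (hw x) (by positivity)

theorem sqInt_mono {w w' : R3 → ℝ} (hw : w.HasTemperateGrowth) (hw' : w'.HasTemperateGrowth)
    (h : ∀ x, w x ≤ w' x) (a : 𝓢(R3, ℂ)) : sqInt w a ≤ sqInt w' a :=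
  integral_mono (integrable_sq hw a) (integrable_sq hw' a) fun x =>
    mul_le_mul_of_nonneg_right (h x) (by positivity)

theorem sqInt_const_mul (c : ℝ) (w : R3 → ℝ) (a : 𝓢(R3, ℂ)) :
    sqInt (fun x => c * w x) a = c * sqInt w a := by
  unfold sqInt; rw [← integral_const_mul]; congr 1; ext x; ring

/-- Young's inequality with reciprocal weights. The parameter `t` is left free so that one of the
two squares can later be absorbed. -/
theorem norm_weightedInt_le {W : R3 → ℝ} {B t : ℝ} (hB : ∀ x, |W x| ≤ B) (ht : 0 < t) (q : ℝ)
    (a b : 𝓢(R3, ℂ)) :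
    ‖weightedInt W a b‖ ≤ B / 2 * (t⁻¹ * sqInt (jb (-q)) a + t * sqInt (jb q) b) := by
  have hB0 : 0 ≤ B := (abs_nonneg _).trans (hB 0)
  have : B / 2 * (t⁻¹ * sqInt (jb (-q)) a + t * sqInt (jb q) b) = ∫ x,
      B / 2 * (t⁻¹ * (jb (-q) x * ‖a x‖ ^ 2) + t * (jb q x * ‖b x‖ ^ 2)) := by
    rw [integral_const_mul, integral_add ((integrable_sq (by fun_prop) a).const_mul _)
      ((integrable_sq (by fun_prop) b).const_mul _), integral_const_mul, integral_const_mul]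
    rfl
  rw [this]
  refine norm_integral_le_of_norm_le ((((integrable_sq (by fun_prop) a).const_mul _).add
      ((integrable_sq (by fun_prop) b).const_mul _)).const_mul _)
      (Filter.Eventually.of_forall fun x => ?_)
  simp only [norm_mul, Complex.norm_real, Real.norm_eq_abs]
  have h1 : ‖a x‖ * ‖b x‖ ≤ 1 / 2 * (t⁻¹ * (jb (-q) x * ‖a x‖ ^ 2) + t * (jb q x * ‖b x‖ ^ 2)) := by
    have hj := jb_pos q x
    have e : t⁻¹ * (jb (-q) x * ‖a x‖ ^ 2) = ‖a x‖ ^ 2 / (t * jb q x) := by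
      have : jb (-q) x = (jb q x)⁻¹ := eq_inv_of_mul_eq_one_right (jb_mul_neg q x)
      rw [this]
      field_simp
    rw [e]
    have hs : 0 < t * jb q x := by positivity
    set s := t * jb q x
    have : t * (jb q x * ‖b x‖ ^ 2) = s * ‖b x‖ ^ 2 := by simp only [s]; ring
    rw [this, ← sub_nonneg]
    have : 1 / 2 * (‖a x‖ ^ 2 / s + s * ‖b x‖ ^ 2) - ‖a x‖ * ‖b x‖ =
        (‖a x‖ - s * ‖b x‖) ^ 2 / (2 * s) := by field_simp; ring
    rw [this]; positivity
  calc |W x| * ‖a x‖ * ‖b x‖ ≤ B * (‖a x‖ * ‖b x‖) := by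
        rw [mul_assoc]; exact mul_le_mul_of_nonneg_right (hB x) (by positivity)
    _ ≤ B * _ := mul_le_mul_of_nonneg_left h1 hB0
    _ = _ := by ring

theorem sqInt_conjS (w : R3 → ℝ) (a : 𝓢(R3, ℂ)) : sqInt w (conjS a) = sqInt w a := by
  unfold sqInt; simp

theorem conjS_laplacian (u : 𝓢(R3, ℂ)) : conjS (Δ u) = Δ (conjS u) := by
  simp only [laplacian_eq_sum_partialD, partialD_conjS]
  ext x; simp [Fin.sum_univ_three]

/-! ### Energy and momentum identities for the Helmholtz operator. -/

/-- The Helmholtz operator `-Δ - z²`. -/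
def helmholtz (z : ℂ) (u : 𝓢(R3, ℂ)) : 𝓢(R3, ℂ) := -(Δ u) - z ^ 2 • u

theorem weightedInt_helmholtz {W : R3 → ℝ} (hW : W.HasTemperateGrowth) (z : ℂ) (u b : 𝓢(R3, ℂ)) :
    weightedInt W (helmholtz z u) b = - weightedInt W (Δ u) b - z ^ 2 * weightedInt W u b := by
  unfold helmholtz
  rw [sub_eq_add_neg, weightedInt_add_left hW, weightedInt_neg_left, weightedInt_neg_left,
    weightedInt_smul_left]; ring

theorem re_energy {w : R3 → ℝ} {w1 w2 : Fin 3 → R3 → ℝ} (hw : w.HasTemperateGrowth)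
    (hw1 : ∀ i, (w1 i).HasTemperateGrowth) (hw2 : ∀ i, (w2 i).HasTemperateGrowth)
    (h1 : ∀ i x, HasLineDerivAt ℝ w (w1 i x) x (unitVec i))
    (h2 : ∀ i x, HasLineDerivAt ℝ (w1 i) (w2 i x) x (unitVec i)) (z : ℂ) (u : 𝓢(R3, ℂ)) :
    (weightedInt w (helmholtz z u) (conjS u)).re =
      ∑ i, sqInt w (partialD i u) - 1 / 2 * ∑ i, sqInt (w2 i) u - (z ^ 2).re * sqInt w u := by
  rw [weightedInt_helmholtz hw, weightedInt_conjS_self]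
  have e := energy_identity hw hw1 hw2 h1 h2 u (conjS u)
  have e' : weightedInt w (Δ (conjS u)) u = (starRingEnd ℂ) (weightedInt w (Δ u) (conjS u)) := by
    rw [conj_weightedInt, conjS_conjS, conjS_laplacian]
  rw [e'] at e
  simp only [partialD_conjS, weightedInt_conjS_self] at e
  have := congrArg Complex.re e
  rw [Complex.add_conj] at this
  simp only [← Complex.ofReal_sum] at this
  have e3 : ∀ a b : ℝ, (-2 * (a : ℂ) + (b : ℂ)).re = -2 * a + b := by intro a b; simp
  rw [e3, Complex.ofReal_re] at this
  simp only [Complex.sub_re, Complex.neg_re, Complex.re_mul_ofReal]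
  linarith

/-- The weight is identically one, so no derivative of it appears and the identity holds with both
real and imaginary parts. The imaginary part yields the bound on `Im z² ∫|u|²`. -/
theorem weightedInt_one_helmholtz (z : ℂ) (u : 𝓢(R3, ℂ)) :
    weightedInt (jb 0) (helmholtz z u) (conjS u) =
      ((∑ i, sqInt (jb 0) (partialD i u) : ℝ) : ℂ) - z ^ 2 * (sqInt (jb 0) u : ℂ) := by
  rw [weightedInt_helmholtz (by fun_prop), weightedInt_conjS_self, laplacian_eq_sum_partialD,
    weightedInt_sum_left (by fun_prop), Complex.ofReal_sum, ← Finset.sum_neg_distrib]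
  congr 1
  refine Finset.sum_congr rfl fun i _ => ?_
  have h := weightedInt_partialD (W' := fun _ => 0) (j := i) (jb_hasTemperateGrowth 0) (by fun_prop)
    (fun x => by convert! hasRadialDeriv_jb 0 i x using 1; simp) (partialD i u) (conjS u)
  rw [partialD_conjS, weightedInt_conjS_self] at h
  have h0 : weightedInt (fun _ => 0) (partialD i u) (conjS u) = 0 := by simp [weightedInt]
  rw [h0] at h
  linear_combination -h

/-- The multiplier is `F·∇ū + ½(div F)ū`. The half divergence is chosen to cancel both the `Re z²`
term and the term `div F |∇u|²`, leaving the quadratic form of `∂_i F_j`. -/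
theorem re_momentum {F : Fin 3 → R3 → ℝ} {F' : Fin 3 → Fin 3 → R3 → ℝ}
    (hF : ∀ j, (F j).HasTemperateGrowth) (hF' : ∀ i j, (F' i j).HasTemperateGrowth)
    (h : ∀ i j x, HasLineDerivAt ℝ (F j) (F' i j x) x (unitVec i))
    {w : R3 → ℝ} {w1 w2 : Fin 3 → R3 → ℝ} (hw : w.HasTemperateGrowth)
    (hw1 : ∀ i, (w1 i).HasTemperateGrowth) (hw2 : ∀ i, (w2 i).HasTemperateGrowth)
    (h1 : ∀ i x, HasLineDerivAt ℝ w (w1 i x) x (unitVec i))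
    (h2 : ∀ i x, HasLineDerivAt ℝ (w1 i) (w2 i x) x (unitVec i))
    (hdiv : ∀ x, w x = ∑ j, F' j j x) (z : ℂ) (u : 𝓢(R3, ℂ)) :
    ∑ j, (weightedInt (F j) (helmholtz z u) (conjS (partialD j u))).re
        + 1 / 2 * (weightedInt w (helmholtz z u) (conjS u)).re =
      ∑ j, ∑ i, (weightedInt (F' i j) (partialD i u) (conjS (partialD j u))).re
        - 1 / 4 * ∑ i, sqInt (w2 i) u
        + (z ^ 2).im * (∑ j, weightedInt (F j) u (conjS (partialD j u))).im := by
  have hsum : ∀ a b, weightedInt w a b = ∑ j, weightedInt (F' j j) a b := by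
    intro a b
    unfold weightedInt
    rw [← integral_finsetSum _ fun j _ => integrable_weight_mul_mul (hF' j j) a b]
    congr 1; ext x; rw [hdiv x]; push_cast; rw [Finset.sum_mul, Finset.sum_mul]
  rw [re_energy hw hw1 hw2 h1 h2]
  have A := congrArg Complex.re (momentum_identity hF hF' h u (conjS u))
  have B := transport_identity hF hF' h u (conjS u)
  rw [← hsum, weightedInt_conjS_self] at B
  have c1 : ∀ j, weightedInt (F j) (conjS u) (partialD j u)
      = (starRingEnd ℂ) (weightedInt (F j) u (conjS (partialD j u))) := by
    intro j; rw [conj_weightedInt, conjS_conjS]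
  have c2 : ∀ j, weightedInt (F j) (Δ (conjS u)) (partialD j u)
      = (starRingEnd ℂ) (weightedInt (F j) (Δ u) (conjS (partialD j u))) := by
    intro j; rw [conj_weightedInt, conjS_conjS, conjS_laplacian]
  have c3 : ∀ i j, weightedInt (F' i j) (conjS (partialD i u)) (partialD j u)
      = (starRingEnd ℂ) (weightedInt (F' i j) (partialD i u) (conjS (partialD j u))) := by
    intro i j; rw [conj_weightedInt, conjS_conjS]
  simp only [partialD_conjS, c1, ← map_sum] at B
  simp only [partialD_conjS, c2, c3] at A
  rw [Complex.add_conj] at B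
  have B' := congrArg Complex.re B
  rw [Complex.ofReal_re, Complex.neg_re, Complex.ofReal_re] at B'
  have A1 : ∑ j, ∑ i, (weightedInt (F' j j) (partialD i u) (conjS (partialD i u))).re
      = ∑ i, sqInt w (partialD i u) := by
    rw [Finset.sum_comm]
    refine Finset.sum_congr rfl fun i _ => ?_
    rw [← Complex.re_sum, ← hsum, weightedInt_conjS_self, Complex.ofReal_re]
  simp only [Complex.re_sum, Complex.add_re, Complex.sub_re, Complex.conj_re,
    Finset.sum_sub_distrib, Finset.sum_add_distrib] at A
  rw [A1] at A
  simp only [weightedInt_helmholtz (hF _), Complex.sub_re, Complex.neg_re,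
    Finset.sum_sub_distrib, Finset.sum_neg_distrib]
  have D : ∑ j, (z ^ 2 * weightedInt (F j) u (conjS (partialD j u))).re
      = (z ^ 2).re * (∑ j, weightedInt (F j) u (conjS (partialD j u))).re
        - (z ^ 2).im * (∑ j, weightedInt (F j) u (conjS (partialD j u))).im := by
    rw [← Complex.mul_re, Finset.mul_sum, Complex.re_sum]
  rw [D]
  -- The real part of `∫ u F·∇ū` is `-½ ∫ div F |u|²` by the transport identity; only its imaginary
  -- part survives.
  generalize (∑ j, weightedInt (F j) u (conjS (partialD j u))).im = im at *
  generalize (∑ j, weightedInt (F j) u (conjS (partialD j u))).re = re at *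
  have : re = - sqInt w u / 2 := by linarith
  rw [this]
  linear_combination (-1/2) * A

/-! ### The multiplier field and its sign properties. -/

/-- The profile `h` of the multiplier field `x h(x)`, with `q = -1 - e`. -/
def fieldProfile (q : ℝ) (x : R3) : ℝ := 2 * jb (-1) x + (-1) * jb q x

/-- The radial derivative of `fieldProfile`. -/
def fieldProfile' (q : ℝ) (x : R3) : ℝ := 2 * ((-1) * jb (-1 - 2) x) + (-1) * (q * jb (q - 2) x)

/-- The divergence of the field `x h(x)`. -/
def fieldDiv (q : ℝ) (x : R3) : ℝ :=
  (4 * jb (-1) x + 2 * jb (-3) x) + ((-(3 + q)) * jb q x + q * jb (q - 2) x)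

/-- The radial derivative of `fieldDiv`. -/
def fieldDiv' (q : ℝ) (x : R3) : ℝ :=
  (4 * ((-1) * jb (-1 - 2) x) + 2 * ((-3) * jb (-3 - 2) x)) +
    ((-(3 + q)) * (q * jb (q - 2) x) + q * ((q - 2) * jb (q - 2 - 2) x))

/-- The second radial derivative of `fieldDiv`. -/
def fieldDiv'' (q : ℝ) (x : R3) : ℝ :=
  (4 * ((-1) * ((-1 - 2) * jb (-1 - 2 - 2) x)) + 2 * ((-3) * ((-3 - 2) * jb (-3 - 2 - 2) x))) +
    ((-(3 + q)) * (q * ((q - 2) * jb (q - 2 - 2) x)) +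
      q * ((q - 2) * ((q - 2 - 2) * jb (q - 2 - 2 - 2) x)))

theorem hasRadialDeriv_fieldProfile (q : ℝ) :
    HasRadialDeriv (fieldProfile q) (fieldProfile' q) :=
  ((hasRadialDeriv_jb _).const_mul _).add ((hasRadialDeriv_jb _).const_mul _)

theorem hasRadialDeriv_fieldDiv (q : ℝ) : HasRadialDeriv (fieldDiv q) (fieldDiv' q) :=
  (((hasRadialDeriv_jb _).const_mul _).add ((hasRadialDeriv_jb _).const_mul _)).add
    (((hasRadialDeriv_jb _).const_mul _).add ((hasRadialDeriv_jb _).const_mul _))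

theorem hasRadialDeriv_fieldDiv' (q : ℝ) : HasRadialDeriv (fieldDiv' q) (fieldDiv'' q) :=
  ((((hasRadialDeriv_jb _).const_mul _).const_mul _).add
    (((hasRadialDeriv_jb _).const_mul _).const_mul _)).add
    ((((hasRadialDeriv_jb _).const_mul _).const_mul _).add
      (((hasRadialDeriv_jb _).const_mul _).const_mul _))

@[fun_prop]
theorem fieldProfile_hasTemperateGrowth (q : ℝ) : (fieldProfile q).HasTemperateGrowth := by
  unfold fieldProfile; fun_prop

@[fun_prop]
theorem fieldProfile'_hasTemperateGrowth (q : ℝ) : (fieldProfile' q).HasTemperateGrowth := by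
  unfold fieldProfile'; fun_prop

@[fun_prop]
theorem fieldDiv_hasTemperateGrowth (q : ℝ) : (fieldDiv q).HasTemperateGrowth := by
  unfold fieldDiv; fun_prop

@[fun_prop]
theorem fieldDiv'_hasTemperateGrowth (q : ℝ) : (fieldDiv' q).HasTemperateGrowth := by
  unfold fieldDiv'; fun_prop

@[fun_prop]
theorem fieldDiv''_hasTemperateGrowth (q : ℝ) : (fieldDiv'' q).HasTemperateGrowth := by
  unfold fieldDiv''; fun_prop

theorem jb_neg_one_sq_mul (x : R3) : jb (-1) x ^ 2 * (1 + ‖x‖ ^ 2) = 1 := by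
  rw [← jb_two, sq, ← jb_add, ← jb_add]; norm_num [jb_zero]

theorem jb_sub_two (p : ℝ) (x : R3) : jb (p - 2) x = jb p x * jb (-1) x ^ 2 := by
  rw [sq, ← jb_add, ← jb_add]; congr 1; ring

theorem jb_neg_one_sub (e : ℝ) (x : R3) : jb (-1 - e) x = jb (-1) x * jb (-e) x := by
  rw [← jb_add]; congr 1

/-- Writing `|x|² = ⟨x⟩² - 1` turns the divergence into a combination of pure bracket powers, which
is how `fieldDiv` is defined and why it is easy to differentiate again. -/
theorem fieldDiv_eq (q : ℝ) (x : R3) :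
    fieldDiv q x = 3 * fieldProfile q x + ‖x‖ ^ 2 * fieldProfile' q x := by
  have h := jb_neg_one_sq_mul x
  have h3 : jb (-3) x = jb (-1) x * jb (-1) x ^ 2 := by rw [← jb_sub_two]; norm_num
  unfold fieldDiv fieldProfile fieldProfile'
  rw [h3]
  simp only [jb_sub_two]
  linear_combination (2 * jb (-1) x + q * jb q x) * h

/-- The left side is the Laplacian of the radial function `fieldDiv`. Its sign makes the `|u|²` term
of the momentum identity favourable. -/
theorem laplacian_fieldDiv_nonpos {e : ℝ} (he : 0 < e) (he' : e ≤ 1 / 5) (x : R3) :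
    3 * fieldDiv' (-1 - e) x + ‖x‖ ^ 2 * fieldDiv'' (-1 - e) x ≤ 0 := by
  have h := jb_neg_one_sq_mul x
  have h3 : jb (-3) x = jb (-1) x * jb (-1) x ^ 2 := by rw [← jb_sub_two]; norm_num
  have hb := jb_pos (-1) x
  have hβ := jb_pos (-e) x
  have hβ1 : jb (-e) x ≤ 1 := jb_le_one (by linarith) x
  unfold fieldDiv' fieldDiv''
  simp only [jb_sub_two, jb_neg_one_sub, h3]
  generalize jb (-1) x = b at *
  generalize jb (-e) x = β at *
  generalize ‖x‖ ^ 2 = t at *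
  have e1 : t * b ^ 2 = 1 - b ^ 2 := by linarith
  -- With `b = ⟨x⟩⁻¹` and `β = ⟨x⟩^(-e)`, eliminating `|x|²` leaves only powers of `b`. The part
  -- `2⟨x⟩⁻¹` of the profile contributes `30 b⁷`, which dominates the one term of opposite sign.
  have key : 3 * (4 * (-1 * (b * b ^ 2)) + 2 * (-3 * (b * b ^ 2 * b ^ 2)) +
      (-(3 + (-1 - e)) * ((-1 - e) * (b * β * b ^ 2)) +
        (-1 - e) * ((-1 - e - 2) * (b * β * b ^ 2 * b ^ 2)))) +
      t * (4 * (-1 * ((-1 - 2) * (b * b ^ 2 * b ^ 2))) +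
        2 * (-3 * ((-3 - 2) * (b * b ^ 2 * b ^ 2 * b ^ 2))) +
        (-(3 + (-1 - e)) * ((-1 - e) * ((-1 - e - 2) * (b * β * b ^ 2 * b ^ 2))) +
          (-1 - e) * ((-1 - e - 2) * ((-1 - e - 2 - 2) * (b * β * b ^ 2 * b ^ 2 * b ^ 2))))) =
      - (b ^ 7 * (30 - (1 + e) * (3 + e) * (5 + e) * β) +
        β * ((1 + e) * e * (2 - e) * b ^ 3 + 2 * e * (1 + e) * (3 + e) * b ^ 5)) := by
    linear_combination (12 * b ^ 3 + 30 * b ^ 5 + (2 - e) * (-(1 + e) * (3 + e)) * β * b ^ 3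
      - (1 + e) * (3 + e) * (5 + e) * β * b ^ 5) * e1
  rw [key, neg_nonpos]
  have h30 : (1 + e) * (3 + e) * (5 + e) * β ≤ 30 := by
    have h1 : (1 + e) * (3 + e) ≤ 4 := by nlinarith
    have h2 : (1 + e) * (3 + e) * (5 + e) ≤ 30 := by nlinarith
    nlinarith [mul_nonneg (mul_nonneg (by linarith : 0 ≤ 1 + e) (by linarith : 0 ≤ 3 + e))
      (by linarith : 0 ≤ 5 + e)]
  have h2e : 0 ≤ 2 - e := by linarith
  have : 0 ≤ 30 - (1 + e) * (3 + e) * (5 + e) * β := by linarith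
  positivity

theorem abs_fieldDiv_le {e : ℝ} (he : 0 < e) (he' : e ≤ 1 / 5) (x : R3) :
    |fieldDiv (-1 - e) x| ≤ 11 := by
  unfold fieldDiv
  have a1 := jb_pos (-1) x
  have a2 := jb_pos (-3) x
  have a3 := jb_pos (-1 - e) x
  have a4 := jb_pos (-1 - e - 2) x
  have b1 : jb (-1) x ≤ 1 := jb_le_one (by linarith) x
  have b2 : jb (-3) x ≤ 1 := jb_le_one (by linarith) x
  have b3 : jb (-1 - e) x ≤ 1 := jb_le_one (by linarith) x
  have b4 : jb (-1 - e - 2) x ≤ 1 := jb_le_one (by linarith) x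
  rw [abs_le]
  constructor <;> nlinarith

theorem abs_coord_mul_fieldProfile_le {e : ℝ} (he : 0 < e) (j : Fin 3) (x : R3) :
    |x j * fieldProfile (-1 - e) x| ≤ 2 := by
  have hb := jb_pos (-1) x
  have hβ := jb_pos (-e) x
  have hβ1 : jb (-e) x ≤ 1 := jb_le_one (by linarith) x
  have h := jb_neg_one_sq_mul x
  have hx : |x j| ≤ ‖x‖ := by simpa using PiLp.norm_apply_le x j
  have h1 : |x j| * jb (-1) x ≤ 1 := by
    have h2 : ‖x‖ * jb (-1) x ≤ 1 := by
      apply abs_le_of_sq_le_sq' _ zero_le_one |>.2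
      nlinarith
    nlinarith
  unfold fieldProfile
  rw [jb_neg_one_sub, abs_mul, show 2 * jb (-1) x + -1 * (jb (-1) x * jb (-e) x)
    = jb (-1) x * (2 - jb (-e) x) by ring, abs_mul, abs_of_pos hb, ← mul_assoc]
  calc _ ≤ 1 * |2 - jb (-e) x| := by gcongr
    _ ≤ 2 := by rw [one_mul, abs_le]; constructor <;> linarith

/-- Lower bound for the quadratic form of the derivative of the field. -/
theorem field_form_lower {e : ℝ} (he : 0 < e) (he' : e ≤ 1 / 5) (x : R3) {S R : ℝ} (hS : 0 ≤ S)
    (hRS : R ≤ ‖x‖ ^ 2 * S) :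
    e * jb (-1 - e) x * S ≤ fieldProfile (-1 - e) x * S + fieldProfile' (-1 - e) x * R := by
  have h := jb_neg_one_sq_mul x
  have hb := jb_pos (-1) x
  have hβ := jb_pos (-e) x
  have hβ1 : jb (-e) x ≤ 1 := jb_le_one (by linarith) x
  unfold fieldProfile fieldProfile'
  simp only [jb_sub_two, jb_neg_one_sub]
  have ht : 0 ≤ ‖x‖ ^ 2 := by positivity
  generalize jb (-1) x = b at *
  generalize jb (-e) x = β at *
  generalize ‖x‖ ^ 2 = t at *
  have e0 : 2 * (-1 * (b * b ^ 2)) + -1 * ((-1 - e) * (b * β * b ^ 2))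
      = b ^ 3 * ((1 + e) * β - 2) := by ring
  rw [e0]
  -- The profile decreases radially, so the worst case is a purely radial gradient, `R = |x|² S`.
  -- There the form equals `b³(2 - β + eβ|x|²)`, against `b³(eβ + eβ|x|²)` for the claimed bound.
  have hK : (1 + e) * β - 2 ≤ 0 := by nlinarith
  have h1 : b ^ 3 * ((1 + e) * β - 2) * (t * S) ≤ b ^ 3 * ((1 + e) * β - 2) * R := by
    have : b ^ 3 * ((1 + e) * β - 2) ≤ 0 := mul_nonpos_of_nonneg_of_nonpos (by positivity) hK
    exact mul_le_mul_of_nonpos_left hRS this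
  have h2 : (2 * b + -1 * (b * β)) + b ^ 3 * ((1 + e) * β - 2) * t
      = b ^ 3 * (2 - β + e * β * t) := by
    linear_combination (-(2 * b) + b * β) * h
  have h3 : e * (b * β) = b ^ 3 * (e * β + e * β * t) := by linear_combination (-e * b * β) * h
  have h4 : e * β ≤ 2 - β := by nlinarith
  have h5 : e * (b * β) ≤ (2 * b + -1 * (b * β)) + b ^ 3 * ((1 + e) * β - 2) * t := by
    rw [h2, h3]
    exact mul_le_mul_of_nonneg_left (by linarith) (by positivity)
  nlinarith [mul_le_mul_of_nonneg_right h5 hS]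

theorem sum_weightedInt_field_lower {e : ℝ} (he : 0 < e) (he' : e ≤ 1 / 5) (u : 𝓢(R3, ℂ)) :
    e * ∑ i, sqInt (jb (-1 - e)) (partialD i u) ≤
      ∑ j : Fin 3, ∑ i : Fin 3, (weightedInt (fun x => (if i = j then 1 else 0) *
        fieldProfile (-1 - e) x + x j * x i * fieldProfile' (-1 - e) x)
        (partialD i u) (conjS (partialD j u))).re := by
  have hT : ∀ i j : Fin 3, (fun x : R3 => (if i = j then (1 : ℝ) else 0) *
        fieldProfile (-1 - e) x + x j * x i * fieldProfile' (-1 - e) x).HasTemperateGrowth := by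
    intro i j; fun_prop
  have hre : ∀ i j : Fin 3, (weightedInt (fun x => (if i = j then 1 else 0) *
        fieldProfile (-1 - e) x + x j * x i * fieldProfile' (-1 - e) x)
        (partialD i u) (conjS (partialD j u))).re = ∫ x : R3, ((if i = j then 1 else 0) *
        fieldProfile (-1 - e) x + x j * x i * fieldProfile' (-1 - e) x) *
        (partialD i u x * (starRingEnd ℂ) (partialD j u x)).re := by
    intro i j
    unfold weightedInt
    rw [← RCLike.re_eq_complex_re, ← integral_re (integrable_weight_mul_mul (hT i j) _ _)]
    congr 1; ext x
    rw [mul_assoc, RCLike.re_eq_complex_re, Complex.re_ofReal_mul]; rfl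
  have hint : ∀ i j : Fin 3, Integrable (fun x : R3 => ((if i = j then 1 else 0) *
        fieldProfile (-1 - e) x + x j * x i * fieldProfile' (-1 - e) x) *
        (partialD i u x * (starRingEnd ℂ) (partialD j u x)).re) := by
    intro i j
    refine (integrable_weight_mul_mul (hT i j) (partialD i u) (conjS (partialD j u))).re.congr
      (Filter.Eventually.of_forall fun x => ?_)
    simp only [RCLike.re_eq_complex_re]
    rw [mul_assoc, Complex.re_ofReal_mul]; rfl
  simp only [hre]
  have e1 : ∀ j : Fin 3, ∑ i : Fin 3, ∫ x : R3, ((if i = j then 1 else 0) *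
        fieldProfile (-1 - e) x + x j * x i * fieldProfile' (-1 - e) x) *
        (partialD i u x * (starRingEnd ℂ) (partialD j u x)).re
      = ∫ x : R3, ∑ i : Fin 3, ((if i = j then 1 else 0) *
        fieldProfile (-1 - e) x + x j * x i * fieldProfile' (-1 - e) x) *
        (partialD i u x * (starRingEnd ℂ) (partialD j u x)).re := fun j =>
    (integral_finsetSum _ fun i _ => hint i j).symm
  simp only [e1]
  rw [← integral_finsetSum _ fun j _ => integrable_finsetSum _ fun i _ => hint i j]
  unfold sqInt
  rw [← integral_finsetSum _ fun i _ => integrable_sq (by fun_prop) _, ← integral_const_mul]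
  refine integral_mono
    ((integrable_finsetSum _ fun i _ => integrable_sq (by fun_prop) _).const_mul _)
    (integrable_finsetSum _ fun j _ => integrable_finsetSum _ fun i _ => hint i j) fun x => ?_
  have key := field_form_lower he he' x (S := ‖partialD 0 u x‖ ^ 2 + ‖partialD 1 u x‖ ^ 2 +
    ‖partialD 2 u x‖ ^ 2) (R := ‖x 0 * partialD 0 u x + x 1 * partialD 1 u x +
      x 2 * partialD 2 u x‖ ^ 2) (by positivity) (by
    rw [norm_sq_eq_sum]
    simp only [← Complex.normSq_eq_norm_sq, Complex.normSq_apply, Complex.add_re, Complex.add_im,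
      Complex.re_ofReal_mul, Complex.im_ofReal_mul]
    -- Cauchy-Schwarz `|x·∇u|² ≤ |x|²|∇u|²`: the squares are the cross terms of Lagrange's identity,
    -- for real and imaginary parts separately.
    nlinarith [sq_nonneg (x 0 * (partialD 1 u x).re - x 1 * (partialD 0 u x).re),
      sq_nonneg (x 0 * (partialD 2 u x).re - x 2 * (partialD 0 u x).re),
      sq_nonneg (x 1 * (partialD 2 u x).re - x 2 * (partialD 1 u x).re),
      sq_nonneg (x 0 * (partialD 1 u x).im - x 1 * (partialD 0 u x).im),
      sq_nonneg (x 0 * (partialD 2 u x).im - x 2 * (partialD 0 u x).im),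
      sq_nonneg (x 1 * (partialD 2 u x).im - x 2 * (partialD 1 u x).im)])
  simp only [Fin.sum_univ_three]
  refine le_trans (le_of_eq ?_) (key.trans (le_of_eq ?_))
  · ring
  · simp only [← Complex.normSq_eq_norm_sq, Complex.normSq_apply, Complex.add_re, Complex.add_im,
      Complex.im_ofReal_mul, Complex.mul_re, Complex.conj_re,
      Complex.conj_im]
    simp
    ring

/-! ### The weighted `L²` resolvent estimate. -/

/-- The real energy identity with weight `⟨x⟩^(-1-e)`, for which `-Δw ≤ (1+e)(3+e) w ≤ 3.84 w`; half
of this is the constant `1.92`. -/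
theorem helmholtz_energy_bound {e : ℝ} (he : 0 < e) (he' : e ≤ 1 / 5) (z : ℂ) (u : 𝓢(R3, ℂ)) :
    (z ^ 2).re * sqInt (jb (-1 - e)) u ≤ ∑ i, sqInt (jb (-1 - e)) (partialD i u)
      + 1.92 * sqInt (jb (-1 - e)) u
      + ‖weightedInt (jb (-1 - e)) (helmholtz z u) (conjS u)‖ := by
  set q := -1 - e with hq
  have h := re_energy (w := jb q) (w1 := fun i x => x i * (q * jb (q - 2) x))
    (w2 := fun i x => (if i = i then 1 else 0) * (q * jb (q - 2) x) +
      x i * x i * (q * ((q - 2) * jb (q - 2 - 2) x)))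
    (by fun_prop) (by intro i; fun_prop) (by intro i; fun_prop)
    (hasRadialDeriv_jb q)
    (fun i x => ((hasRadialDeriv_jb (q - 2)).const_mul q).coord_mul i i x) z u
  have h2 : - (∑ i : Fin 3, sqInt (fun x => (if i = i then 1 else 0) * (q * jb (q - 2) x) +
      x i * x i * (q * ((q - 2) * jb (q - 2 - 2) x))) u) ≤ 3.84 * sqInt (jb q) u := by
    rw [← sqInt_const_mul]
    unfold sqInt
    rw [← integral_finsetSum _ fun i _ => integrable_sq (by fun_prop) _, ← integral_neg]
    refine integral_mono (integrable_finsetSum _ fun i _ => integrable_sq (by fun_prop) _).neg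
      (integrable_sq (by fun_prop) u) fun x => ?_
    simp only [Fin.sum_univ_three]
    have hb := jb_neg_one_sq_mul x
    have hb0 := jb_pos (-1) x
    have hj := jb_pos q x
    have hn := norm_sq_eq_sum x
    have e1 : jb (q - 2 - 2) x = jb q x * jb (-1) x ^ 4 := by rw [jb_sub_two, jb_sub_two]; ring
    have hb1 : jb (-1) x ≤ 1 := jb_le_one (by linarith) x
    rw [e1, jb_sub_two]
    have e2 : - (3 * (q * (jb q x * jb (-1) x ^ 2)) +
        ‖x‖ ^ 2 * (q * ((q - 2) * (jb q x * jb (-1) x ^ 4))))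
        = jb q x * ((1 + e) * (3 + e) * jb (-1) x ^ 4 - e * (1 + e) * jb (-1) x ^ 2) := by
      rw [hq] at *
      linear_combination (-(1 + e) * (3 + e) * jb (-1 - e) x * jb (-1) x ^ 2) * hb
    have e3 : (1 + e) * (3 + e) * jb (-1) x ^ 4 - e * (1 + e) * jb (-1) x ^ 2 ≤ 3.84 := by
      have h4 : jb (-1) x ^ 4 ≤ 1 := pow_le_one₀ hb0.le hb1
      have h5 : (1 + e) * (3 + e) ≤ 3.84 := by nlinarith
      have h6 : 0 ≤ e * (1 + e) * jb (-1) x ^ 2 := by positivity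
      have h7 : 0 ≤ (1 + e) * (3 + e) := by positivity
      nlinarith
    have e4 := mul_le_mul_of_nonneg_left e3 hj.le
    rw [← e2, hn] at e4
    have e5 := mul_le_mul_of_nonneg_right e4 (sq_nonneg ‖u x‖)
    refine le_trans (le_of_eq ?_) (e5.trans (le_of_eq ?_))
    · simp; ring
    · ring
  have h3 := Complex.re_le_norm (weightedInt (jb q) (helmholtz z u) (conjS u))
  have h4 := Complex.abs_re_le_norm (weightedInt (jb q) (helmholtz z u) (conjS u))
  have h5 := neg_abs_le (weightedInt (jb q) (helmholtz z u) (conjS u)).re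
  linarith

/-- The field is bounded but does not decay, so the term with `Im z²` involves unweighted norms of
`u` and `∇u`. The factor `3` counts the components of the field. -/
theorem helmholtz_momentum_bound {e : ℝ} (he : 0 < e) (he' : e ≤ 1 / 5) (z : ℂ)
    (hz : 0 ≤ (z ^ 2).im) (u : 𝓢(R3, ℂ)) {t s : ℝ} (ht : 0 < t) (hs : 0 < s) :
    e * ∑ i, sqInt (jb (-1 - e)) (partialD i u) ≤
      3 * t⁻¹ * sqInt (jb (-(-1 - e))) (helmholtz z u)
        + t * ∑ i, sqInt (jb (-1 - e)) (partialD i u)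
        + 1 / 2 * ‖weightedInt (fieldDiv (-1 - e)) (helmholtz z u) (conjS u)‖
        + (z ^ 2).im * (3 * s⁻¹ * sqInt (jb 0) u + s * ∑ i, sqInt (jb 0) (partialD i u)) := by
  set q := -1 - e with hq
  have h := re_momentum (F := fun j x => x j * fieldProfile q x)
    (F' := fun i j x => (if i = j then 1 else 0) *
        fieldProfile q x + x j * x i * fieldProfile' q x) (w := fieldDiv q)
    (w1 := fun i x => x i * fieldDiv' q x)
    (w2 := fun i x => (if i = i then 1 else 0) * fieldDiv' q x + x i * x i * fieldDiv'' q x)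
    (by intro j; fun_prop) (by intro i j; fun_prop)
    (fun i j x => (hasRadialDeriv_fieldProfile q).coord_mul i j x)
    (by fun_prop) (by intro i; fun_prop) (by intro i; fun_prop)
    (hasRadialDeriv_fieldDiv q) (fun i x => (hasRadialDeriv_fieldDiv' q).coord_mul i i x)
    (by
      intro x
      rw [fieldDiv_eq, norm_sq_eq_sum, Fin.sum_univ_three]; simp; ring) z u
  have hlow := sum_weightedInt_field_lower he he' u
  rw [← hq] at hlow
  have hlap : ∑ i : Fin 3, sqInt (fun x => (if i = i then 1 else 0) * fieldDiv' q x +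
      x i * x i * fieldDiv'' q x) u ≤ 0 := by
    unfold sqInt
    rw [← integral_finsetSum _ fun i _ => integrable_sq (by fun_prop) _]
    refine integral_nonpos fun x => ?_
    have e4 := laplacian_fieldDiv_nonpos he he' x
    rw [norm_sq_eq_sum] at e4
    have e5 := mul_le_mul_of_nonneg_right e4 (sq_nonneg ‖u x‖)
    simp only [Fin.sum_univ_three]
    refine le_trans (le_of_eq ?_) (e5.trans (le_of_eq ?_))
    · simp; ring
    · simp
  have hF : ∀ j : Fin 3, ∀ x : R3, |x j * fieldProfile q x| ≤ 2 := fun j x =>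
    abs_coord_mul_fieldProfile_le he j x
  have h1 : ∑ j : Fin 3, (weightedInt (fun x => x j * fieldProfile q x) (helmholtz z u)
      (conjS (partialD j u))).re ≤ 3 * t⁻¹ * sqInt (jb (-q)) (helmholtz z u)
        + t * ∑ i, sqInt (jb q) (partialD i u) := by
    calc _ ≤ ∑ j : Fin 3, (t⁻¹ * sqInt (jb (-q)) (helmholtz z u) +
          t * sqInt (jb q) (partialD j u)) := by
          refine Finset.sum_le_sum fun j _ => (Complex.re_le_norm _).trans ?_
          have := norm_weightedInt_le (hF j) ht q (helmholtz z u) (conjS (partialD j u))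
          rw [sqInt_conjS] at this
          linarith
      _ = _ := by simp only [Fin.sum_univ_three]; ring
  have h2 : -(∑ j : Fin 3, weightedInt (fun x => x j * fieldProfile q x) u
      (conjS (partialD j u))).im ≤ 3 * s⁻¹ * sqInt (jb 0) u
        + s * ∑ i, sqInt (jb 0) (partialD i u) := by
    calc _ ≤ ‖∑ j : Fin 3, weightedInt (fun x => x j * fieldProfile q x) u
            (conjS (partialD j u))‖ := (neg_le_abs _).trans (Complex.abs_im_le_norm _)
      _ ≤ ∑ j : Fin 3, ‖weightedInt (fun x => x j * fieldProfile q x) u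
            (conjS (partialD j u))‖ := norm_sum_le _ _
      _ ≤ ∑ j : Fin 3, (s⁻¹ * sqInt (jb 0) u + s * sqInt (jb 0) (partialD j u)) := by
          refine Finset.sum_le_sum fun j _ => ?_
          have := norm_weightedInt_le (hF j) hs 0 u (conjS (partialD j u))
          rw [sqInt_conjS, neg_zero] at this
          linarith
      _ = _ := by simp only [Fin.sum_univ_three]; ring
  have h3 := mul_le_mul_of_nonneg_left h2 hz
  have h4 := Complex.re_le_norm (weightedInt (fieldDiv q) (helmholtz z u) (conjS u))
  rw [mul_neg] at h3
  refine hlow.trans ?_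
  rw [← sub_eq_iff_eq_add, eq_sub_iff_add_eq] at h
  rw [← h]
  have h5 := add_le_add (add_le_add (add_le_add h1 (mul_le_mul_of_nonneg_left h4
    (by norm_num : (0 : ℝ) ≤ 1 / 2))) h3) (mul_nonpos_of_nonneg_of_nonpos
    (by norm_num : (0 : ℝ) ≤ 1 / 4) hlap)
  rw [add_zero] at h5
  exact le_trans (le_of_eq (by ring)) h5

/-- The arithmetic that combines the energy and momentum bounds. -/
theorem combine_energy_momentum {e k η X Y U V P Φ : ℝ} (he : 0 < e) (he' : e ≤ 1 / 5) (hk : 2 < k)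
    (hη : 0 < η) (hη' : η ≤ 1) (hX : 0 ≤ X) (hU : 0 ≤ U) (hP0 : 0 ≤ P)
    (hP : P = 1 / 2 * ((e / 68 * k)⁻¹ * Φ + e / 68 * k * X))
    (i1 : 2 * k * η * U ≤ P) (i2 : V ≤ (k ^ 2 - η ^ 2) * U + P)
    (i3 : (k ^ 2 - η ^ 2) * X ≤ Y + 1.92 * X + P)
    (i5 : e * Y ≤ 3 * (e / 2)⁻¹ * Φ + e / 2 * Y + 1 / 2 * (11 * P)
      + 2 * k * η * (3 * (1 / k)⁻¹ * U + 1 / k * V)) :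
    k ^ 2 * X ≤ 4720 / e ^ 2 * Φ := by
  have hk0 : 0 < k := by linarith
  -- The unweighted norms may blow up as `η → 0`, but here they occur only multiplied by `η`, and
  -- `i1` bounds that product uniformly.
  have i7 : 2 * k * η * (3 * (1 / k)⁻¹ * U + 1 / k * V) ≤ 5 * k * P := by
    have hV' : V ≤ k ^ 2 * U + P := by nlinarith [mul_nonneg (sq_nonneg η) hU]
    have a : 3 * (1 / k)⁻¹ * U + 1 / k * V ≤ 4 * k * U + P / k := by
      have : 1 / k * V ≤ 1 / k * (k ^ 2 * U + P) := mul_le_mul_of_nonneg_left hV' (by positivity)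
      have e1 : 1 / k * (k ^ 2 * U + P) = k * U + P / k := by field_simp
      have e2 : 3 * (1 / k)⁻¹ * U = 3 * k * U := by rw [one_div, inv_inv]
      linarith
    have b := mul_le_mul_of_nonneg_left a (by positivity : 0 ≤ 2 * k * η)
    have c : 2 * k * η * (P / k) = 2 * η * P := by field_simp
    have d : 2 * η * P ≤ k * P := mul_le_mul_of_nonneg_right (by linarith) hP0
    have d2 := mul_le_mul_of_nonneg_left i1 (by positivity : 0 ≤ 4 * k)
    have d3 : 2 * k * η * (4 * k * U + P / k) = 4 * k * (2 * k * η * U) + 2 * η * P := by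
      rw [← c]; ring
    linarith
  have i8 : e / 2 * Y ≤ 6 / e * Φ + 8 * k * P := by
    have a : 3 * (e / 2)⁻¹ * Φ = 6 / e * Φ := by rw [inv_div]; ring
    have b : 11 / 2 * P ≤ 3 * k * P := mul_le_mul_of_nonneg_right (by linarith) hP0
    linarith
  have i9 : Y ≤ 12 / e ^ 2 * Φ + 16 / e * (k * P) := by
    have := mul_le_mul_of_nonneg_left i8 (by positivity : 0 ≤ 2 / e)
    have e1 : 2 / e * (e / 2 * Y) = Y := by field_simp
    have e2 : 2 / e * (6 / e * Φ + 8 * k * P) = 12 / e ^ 2 * Φ + 16 / e * (k * P) := by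
      field_simp; ring
    linarith
  have i10 : P ≤ 1 / e * (k * P) := by
    have h1 : 1 ≤ 1 / e * k := by
      rw [div_mul_eq_mul_div, one_mul, le_div_iff₀ he]; linarith
    have := mul_le_mul_of_nonneg_right h1 hP0
    linarith
  have i11 : k * P = 34 / e * Φ + e / 136 * (k ^ 2 * X) := by rw [hP]; field_simp; ring
  -- The Young parameter `e k / 68` makes the coefficient of `k² X` equal to `17/136 = 1/8`, half of
  -- what `i13` provides, so it can be absorbed.
  have i12 : 17 / e * (k * P) = 578 / e ^ 2 * Φ + 1 / 8 * (k ^ 2 * X) := by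
    rw [i11]; field_simp; ring
  have i13 : 1 / 4 * (k ^ 2 * X) ≤ (k ^ 2 - η ^ 2 - 1.92) * X := by
    -- This is where `k > 2` is needed: `¾k² > 3`, while `η² + 1.92 ≤ 2.92`.
    have h1 : 1 / 4 * k ^ 2 ≤ k ^ 2 - η ^ 2 - 1.92 := by nlinarith
    have := mul_le_mul_of_nonneg_right h1 hX
    linarith
  have i14 : 16 / e * (k * P) + 1 / e * (k * P) = 17 / e * (k * P) := by ring
  have i15 : 4720 / e ^ 2 * Φ = 8 * (12 / e ^ 2 * Φ + 578 / e ^ 2 * Φ) := by ring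
  rw [i15]
  linarith

/-- The weighted `L²` resolvent estimate, uniform up to the real axis. -/
theorem helmholtz_weighted_estimate {e : ℝ} (he : 0 < e) (he' : e ≤ 1 / 5) {k η : ℝ} (hk : 2 < k)
    (hη : 0 < η) (hη' : η ≤ 1) (u : 𝓢(R3, ℂ)) :
    k ^ 2 * sqInt (jb (-1 - e)) u ≤
      4720 / e ^ 2 * sqInt (jb (1 + e)) (helmholtz (k + η * Complex.I) u) := by
  set q := -1 - e with hq
  set z : ℂ := k + η * Complex.I with hz
  have hre : (z ^ 2).re = k ^ 2 - η ^ 2 := by simp [hz, sq]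
  have him : (z ^ 2).im = 2 * k * η := by simp [hz, sq]; ring
  set f := helmholtz z u with hf
  have hnq : -q = 1 + e := by rw [hq]; ring
  rw [← hnq]
  set X := sqInt (jb q) u
  set Φ := sqInt (jb (-q)) f
  set Y := ∑ i, sqInt (jb q) (partialD i u)
  set U := sqInt (jb 0) u
  set V := ∑ i, sqInt (jb 0) (partialD i u) with hV
  have hX : 0 ≤ X := sqInt_nonneg (fun x => (jb_pos _ x).le) u
  have hΦ : 0 ≤ Φ := sqInt_nonneg (fun x => (jb_pos _ x).le) f
  have hU : 0 ≤ U := sqInt_nonneg (fun x => (jb_pos _ x).le) u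
  have hτ : 0 < e / 68 * k := by positivity
  set Q := 1 / 2 * ((e / 68 * k)⁻¹ * Φ + e / 68 * k * X) with hQ
  have hQ0 : 0 ≤ Q := by positivity
  have hT : ∀ (W : R3 → ℝ) (B : ℝ), (∀ x, |W x| ≤ B) →
      ‖weightedInt W f (conjS u)‖ ≤ B * Q := by
    intro W B hB
    have := norm_weightedInt_le hB hτ q f (conjS u)
    rw [sqInt_conjS] at this
    refine this.trans (le_of_eq ?_)
    rw [hQ]; ring
  -- The pairing of `f` with `ū` gives `i1` from its imaginary part and `i2` from its real part. It
  -- is bounded with the decaying weight on `u`, so the bound does not involve the unweighted norms.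
  have h0 := weightedInt_one_helmholtz z u
  have hT0 := hT (jb 0) 1 (fun x => by simp [jb_zero])
  rw [hf, h0, one_mul, ← hV] at hT0
  have i1 : 2 * k * η * U ≤ Q := by
    have := (Complex.abs_im_le_norm _).trans hT0
    have := (neg_le_abs _).trans this
    simp only [Complex.sub_im, Complex.ofReal_im, Complex.im_mul_ofReal, him] at this
    linarith
  have i2 : V ≤ (k ^ 2 - η ^ 2) * U + Q := by
    have := (Complex.re_le_norm _).trans hT0
    simp only [Complex.sub_re, Complex.ofReal_re, Complex.re_mul_ofReal, hre] at this
    linarith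
  have i3 := helmholtz_energy_bound he he' z u
  rw [hre] at i3
  have i4 := hT (jb q) 1 (fun x => by
    rw [abs_of_pos (jb_pos _ _)]; exact jb_le_one (by rw [hq]; linarith) x)
  have i5 := helmholtz_momentum_bound he he' z (by rw [him]; positivity) u
    (t := e / 2) (s := 1 / k) (by positivity) (by positivity)
  rw [him] at i5
  have i6 := hT (fieldDiv q) 11 (fun x => abs_fieldDiv_le he he' x)
  refine combine_energy_momentum he he' hk hη hη' hX hU hQ0 hQ i1 i2 ?_ (i5.trans ?_)
  · linarith
  · gcongr

/-! ### Newtonian potentials of rapidly decaying functions. -/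

theorem jb_one (x : R3) : jb 1 x = √(1 + ‖x‖ ^ 2) := by
  unfold jb; rw [Real.sqrt_eq_rpow]

theorem jb_one_le (x y : R3) : jb 1 y ≤ jb 1 x + ‖x - y‖ := by
  have h0 : ‖y‖ ≤ ‖x‖ + ‖x - y‖ := by
    have := norm_sub_le x (x - y); simpa using this
  have h1 : ‖x‖ ≤ √(1 + ‖x‖ ^ 2) := by
    apply Real.le_sqrt_of_sq_le; linarith
  rw [jb_one, jb_one, Real.sqrt_le_left (by positivity)]
  have h2 : √(1 + ‖x‖ ^ 2) ^ 2 = 1 + ‖x‖ ^ 2 := Real.sq_sqrt (by positivity)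
  nlinarith [norm_nonneg y, norm_nonneg (x - y)]

theorem continuous_jb (p : ℝ) : Continuous (jb p) := (jb_hasTemperateGrowth p).1.continuous

theorem integrable_jb {p : ℝ} (hp : 3 < p) : Integrable (jb (-p)) :=
  integrable_rpow_neg_one_add_norm_sq (by simpa using hp)

theorem exists_le_jb (ψ : 𝓢(R3, ℂ)) (p : ℝ) : ∃ M, 0 ≤ M ∧ ∀ x, ‖ψ x‖ ≤ M * jb (-p) x := by
  refine ⟨SchwartzMap.seminorm ℝ 0 0 (SchwartzMap.smulLeftCLM ℂ (jb p) ψ), apply_nonneg _ _,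
    fun x => ?_⟩
  have h := SchwartzMap.norm_le_seminorm ℝ (SchwartzMap.smulLeftCLM ℂ (jb p) ψ) x
  rw [SchwartzMap.smulLeftCLM_apply_apply (by fun_prop), norm_smul,
    Real.norm_of_nonneg (jb_pos p x).le] at h
  have h2 := mul_le_mul_of_nonneg_right h (jb_pos (-p) x).le
  have h3 := jb_mul_neg p x
  calc ‖ψ x‖ = jb p x * jb (-p) x * ‖ψ x‖ := by rw [h3, one_mul]
    _ = jb p x * ‖ψ x‖ * jb (-p) x := by ring
    _ ≤ _ := h2

theorem integrableOn_ball_inv_norm :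
    IntegrableOn (fun x : R3 => ‖x‖⁻¹) (Metric.ball (0 : R3) 1) := by
  rw [integrableOn_fun_norm_addHaar volume (f := fun r : ℝ => r⁻¹)]
  have : IntegrableOn (fun y : ℝ => y) (Set.Ioo 0 1) :=
    (continuous_id.integrableOn_Icc (a := 0) (b := 1)).mono_set Set.Ioo_subset_Icc_self
  refine this.congr_fun (fun y hy => ?_) measurableSet_Ioo
  have := hy.1.ne'
  simp; field_simp

theorem measurable_inv_norm_sub (y : R3) : Measurable (fun x : R3 => ‖x - y‖⁻¹) := by fun_prop

/-- Split at `|x - y| = 1`: the singularity is locally integrable in dimension three, and outside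
the unit ball the kernel is at most one. -/
theorem exists_integral_inv_norm_mul_jb_le : ∃ K, ∀ y : R3,
    Integrable (fun x : R3 => ‖x - y‖⁻¹ * jb (-4) x) ∧
      ∫ x : R3, ‖x - y‖⁻¹ * jb (-4) x ≤ K := by
  set h : R3 → ℝ := (Metric.ball (0 : R3) 1).indicator fun x => ‖x‖⁻¹ with hh
  have hint : Integrable h := (integrable_indicator_iff measurableSet_ball).2
    integrableOn_ball_inv_norm
  have hj : Integrable (jb (-4)) := integrable_jb (by norm_num)
  have hb : ∀ y x : R3, ‖x - y‖⁻¹ * jb (-4) x ≤ h (x - y) + jb (-4) x := by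
    intro y x
    have h0 := jb_pos (-4) x
    have h1 : jb (-4) x ≤ 1 := jb_le_one (by norm_num) x
    by_cases hx : x - y ∈ Metric.ball (0 : R3) 1
    · rw [hh, Set.indicator_of_mem hx]
      have : ‖x - y‖⁻¹ * jb (-4) x ≤ ‖x - y‖⁻¹ := mul_le_of_le_one_right (by positivity) h1
      linarith
    · rw [hh, Set.indicator_of_notMem hx]
      have : 1 ≤ ‖x - y‖ := by simpa using hx
      have : ‖x - y‖⁻¹ ≤ 1 := inv_le_one_of_one_le₀ this
      nlinarith
  have hI : ∀ y, Integrable (fun x : R3 => h (x - y) + jb (-4) x) := fun y =>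
    (hint.comp_sub_right y).add hj
  refine ⟨(∫ x, h x) + ∫ x, jb (-4) x, fun y => ?_⟩
  have hI2 : Integrable (fun x : R3 => ‖x - y‖⁻¹ * jb (-4) x) := by
    refine (hI y).mono' ((measurable_inv_norm_sub y).mul
      (continuous_jb _).measurable).aestronglyMeasurable (Filter.Eventually.of_forall fun x => ?_)
    rw [Real.norm_of_nonneg (mul_nonneg (by positivity) (jb_pos _ _).le)]
    exact hb y x
  refine ⟨hI2, (integral_mono hI2 (hI y) (hb y)).trans (le_of_eq ?_)⟩
  rw [integral_add (hint.comp_sub_right y) hj, integral_sub_right_eq_self]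

/-- The decay comes from `⟨y⟩ ≤ ⟨x⟩ + |x - y|`: the first summand is absorbed by `ψ`, the second
cancels the kernel. The rate `⟨y⟩⁻¹` matches the only integrability available for a general density
in `ResolventIntegrable`. -/
theorem exists_integral_inv_norm_mul_schwartz_le (ψ : 𝓢(R3, ℂ)) : ∃ C, 0 ≤ C ∧ ∀ y : R3,
    Integrable (fun x : R3 => ‖x - y‖⁻¹ * ‖ψ x‖) ∧
      ∫ x : R3, ‖x - y‖⁻¹ * ‖ψ x‖ ≤ C * jb (-1) y := by
  obtain ⟨K, hK⟩ := exists_integral_inv_norm_mul_jb_le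
  obtain ⟨M, hM0, hM⟩ := exists_le_jb ψ 5
  have hK0 : 0 ≤ K := le_trans (integral_nonneg fun x =>
    mul_nonneg (by positivity) (jb_pos _ _).le) (hK 0).2
  have h5 : Integrable (jb (-5)) := integrable_jb (by norm_num)
  have hL : 0 ≤ ∫ x, jb (-5) x := integral_nonneg fun x => (jb_pos _ _).le
  refine ⟨M * (K + ∫ x, jb (-5) x), by positivity, fun y => ?_⟩
  have hle4 : ∀ x, ‖x - y‖⁻¹ * ‖ψ x‖ ≤ M * (‖x - y‖⁻¹ * jb (-4) x) := by
    intro x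
    have := (hM x).trans (mul_le_mul_of_nonneg_left (jb_mono (by norm_num : (-5 : ℝ) ≤ -4) x) hM0)
    calc _ ≤ ‖x - y‖⁻¹ * (M * jb (-4) x) := by gcongr
      _ = _ := by ring
  have hI : Integrable (fun x : R3 => ‖x - y‖⁻¹ * ‖ψ x‖) := by
    refine ((hK y).1.const_mul M).mono' ((measurable_inv_norm_sub y).mul
      ψ.continuous.norm.measurable).aestronglyMeasurable (Filter.Eventually.of_forall fun x => ?_)
    rw [Real.norm_of_nonneg (by positivity)]
    exact hle4 x
  refine ⟨hI, ?_⟩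
  have hpt : ∀ x, jb 1 y * (‖x - y‖⁻¹ * ‖ψ x‖) ≤ M * (‖x - y‖⁻¹ * jb (-4) x + jb (-5) x) := by
    intro x
    have h1 := jb_one_le x y
    have h2 : jb 1 x * jb (-5) x = jb (-4) x := by rw [← jb_add]; norm_num
    have h3 : ‖x - y‖ * ‖x - y‖⁻¹ ≤ 1 := mul_inv_le_one
    calc _ ≤ (jb 1 x + ‖x - y‖) * (‖x - y‖⁻¹ * (M * jb (-5) x)) := by
          gcongr
          · exact add_nonneg (jb_pos _ _).le (norm_nonneg _)
          · exact hM x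
      _ = M * (‖x - y‖⁻¹ * (jb 1 x * jb (-5) x) + (‖x - y‖ * ‖x - y‖⁻¹) * jb (-5) x) := by ring
      _ ≤ _ := by
          rw [h2]
          gcongr
          exact mul_le_of_le_one_left (jb_pos _ _).le h3
  have hint := integral_mono (hI.const_mul (jb 1 y)) (((hK y).1.add h5).const_mul M) hpt
  rw [integral_const_mul, integral_const_mul] at hint
  simp only [Pi.add_apply] at hint
  rw [integral_add (hK y).1 h5] at hint
  have hj : jb (-1) y * jb 1 y = 1 := by rw [← jb_add]; norm_num [jb_zero]
  have h6 := mul_le_mul_of_nonneg_left hint (jb_pos (-1) y).le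
  rw [← mul_assoc, hj, one_mul] at h6
  refine h6.trans ?_
  rw [mul_comm]
  have := (hK y).2
  have := (jb_pos (-1) y).le
  gcongr

/-! ### Green's representation formula by regularizing the kernel. -/

/-- The integral of `⟨w⟩⁻⁵` over `ℝ³`. -/
theorem integral_jb_neg_five : ∫ w : R3, jb (-5) w = 4 * Real.pi / 3 := by
  have h := integral_fun_norm_addHaar (volume : Measure R3)
    (fun r : ℝ => (1 + r ^ 2) ^ (-5 / 2 : ℝ))
  have h1 : ∫ w : R3, jb (-5) w = ∫ x : R3, (fun r : ℝ => (1 + r ^ 2) ^ (-5 / 2 : ℝ)) ‖x‖ := rfl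
  rw [h1, h]
  have h2 : ∫ y in Set.Ioi (0 : ℝ), y ^ (Module.finrank ℝ R3 - 1) • (1 + y ^ 2) ^ (-5 / 2 : ℝ)
      = 1 / 3 := by
    have hd : ∀ x ∈ Set.Ici (0 : ℝ), HasDerivAt
        (fun r : ℝ => 1 / 3 * (r ^ 3 * (1 + r ^ 2) ^ (-3 / 2 : ℝ)))
        (x ^ (Module.finrank ℝ R3 - 1) • (1 + x ^ 2) ^ (-5 / 2 : ℝ)) x := by
      intro x _
      have a : HasDerivAt (fun r : ℝ => 1 + r ^ 2) (2 * x) x := by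
        simpa using (hasDerivAt_pow 2 x).const_add 1
      have b := (a.rpow_const (p := (-3 / 2 : ℝ)) (Or.inl (by positivity)))
      have c := ((hasDerivAt_pow 3 x).mul b).const_mul (1 / 3 : ℝ)
      convert! c using 1
      have e1 : (1 + x ^ 2) ^ (-3 / 2 : ℝ) = (1 + x ^ 2) ^ (-5 / 2 : ℝ) * (1 + x ^ 2) := by
        rw [← Real.rpow_add_one (by positivity)]; norm_num
      have e2 : (1 + x ^ 2) ^ (-3 / 2 - 1 : ℝ) = (1 + x ^ 2) ^ (-5 / 2 : ℝ) := by norm_num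
      rw [e1, e2]
      simp
      ring
    have hlim : Filter.Tendsto (fun r : ℝ => 1 / 3 * (r ^ 3 * (1 + r ^ 2) ^ (-3 / 2 : ℝ)))
        Filter.atTop
        (nhds (1 / 3)) := by
      have t1 : Filter.Tendsto (fun r : ℝ => 1 / 3 * ((1 + (r ^ 2)⁻¹) ^ (-3 / 2 : ℝ)))
        Filter.atTop
          (nhds (1 / 3 * ((1 + 0) ^ (-3 / 2 : ℝ)))) := by
        refine Filter.Tendsto.const_mul _ (Filter.Tendsto.rpow_const ?_ (Or.inl (by norm_num)))
        exact (tendsto_inv_atTop_zero.comp (Filter.tendsto_pow_atTop two_ne_zero)).const_add 1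
      simp only [add_zero, Real.one_rpow, mul_one] at t1
      refine t1.congr' ?_
      filter_upwards [Filter.eventually_gt_atTop 0] with r hr
      have e1 : 1 + r ^ 2 = r ^ 2 * (1 + (r ^ 2)⁻¹) := by field_simp; ring
      have e2 : (r ^ 2) ^ (-3 / 2 : ℝ) = (r ^ 3)⁻¹ := by
        rw [← Real.rpow_natCast r 2, ← Real.rpow_mul hr.le, ← Real.rpow_natCast r 3,
          ← Real.rpow_neg hr.le]
        norm_num
      rw [e1, Real.mul_rpow (by positivity) (by positivity), e2]
      field_simp
    rw [integral_Ioi_of_hasDerivAt_of_nonneg' hd (fun x hx => by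
      have : 0 < x := hx
      positivity) hlim]
    simp
  rw [h2]
  have h3 : (volume : Measure R3).real (Metric.ball 0 1) = Real.pi * 4 / 3 := by
    rw [Measure.real, EuclideanSpace.volume_ball_fin_three]
    simp [ENNReal.toReal_ofReal (by positivity : 0 ≤ Real.pi * 4 / 3)]
  rw [h3]; simp; ring

/-- The regularized distance `√(a² + |y|²)`. -/
def regNorm (a : ℝ) (y : R3) : ℝ := √(a ^ 2 + ‖y‖ ^ 2)

theorem regNorm_pos {a : ℝ} (ha : 0 < a) (y : R3) : 0 < regNorm a y := by
  unfold regNorm; positivity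

theorem le_regNorm {a : ℝ} (y : R3) : a ≤ regNorm a y := by
  unfold regNorm; apply Real.le_sqrt_of_sq_le; nlinarith [sq_nonneg ‖y‖]

theorem norm_le_regNorm (a : ℝ) (y : R3) : ‖y‖ ≤ regNorm a y := by
  unfold regNorm; apply Real.le_sqrt_of_sq_le; nlinarith [sq_nonneg a]

theorem regNorm_sq (a : ℝ) (y : R3) : regNorm a y ^ 2 = a ^ 2 + ‖y‖ ^ 2 :=
  Real.sq_sqrt (by positivity)

theorem continuous_regNorm (a : ℝ) : Continuous (regNorm a) := by
  unfold regNorm; fun_prop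

theorem hasLineDerivAt_regNorm {a : ℝ} (ha : 0 < a) (i : Fin 3) (y : R3) :
    HasLineDerivAt ℝ (regNorm a) (y i / regNorm a y) y (unitVec i) := by
  have h1 : HasFDerivAt (fun x : R3 => a ^ 2 + ‖x‖ ^ 2) (2 • (innerSL ℝ y)) y :=
    (hasStrictFDerivAt_norm_sq y).hasFDerivAt.const_add _
  have h2 := (h1.sqrt (by positivity)).hasLineDerivAt (unitVec i)
  convert! h2 using 1
  simp [regNorm, unitVec, EuclideanSpace.inner_single_right]
  ring

theorem hasLineDerivAt_comp_regNorm {a : ℝ} (ha : 0 < a) (i : Fin 3) (y : R3) {h : ℝ → ℂ} {h' : ℂ}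
    (hh : HasDerivAt h (regNorm a y * h') (regNorm a y)) :
    HasLineDerivAt ℝ (fun y => h (regNorm a y)) ((y i : ℂ) * h') y (unitVec i) := by
  have h1 := hasLineDerivAt_regNorm ha i y
  unfold HasLineDerivAt at h1 ⊢
  have e : regNorm a (y + (0 : ℝ) • unitVec i) = regNorm a y := by simp
  rw [← e] at hh
  have h2 := hh.scomp (0 : ℝ) h1
  convert! h2 using 1
  have := (regNorm_pos ha y).ne'
  have : (regNorm a y : ℂ) ≠ 0 := by exact_mod_cast this
  rw [e]
  simp
  field_simp

/-- The radial profile of the regularized outgoing kernel. -/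
def regG (z : ℂ) (r : ℝ) : ℂ := Complex.exp (Complex.I * z * r) / (4 * Real.pi * r)

/-- The first radial derivative of `regG`, divided by `r`. -/
def regG' (z : ℂ) (r : ℝ) : ℂ :=
  Complex.exp (Complex.I * z * r) / (4 * Real.pi) * (Complex.I * z / r ^ 2 - 1 / r ^ 3)

/-- The first radial derivative of `regG'`, divided by `r`. -/
def regG'' (z : ℂ) (r : ℝ) : ℂ :=
  Complex.exp (Complex.I * z * r) / (4 * Real.pi) *
    (3 / r ^ 5 - 3 * Complex.I * z / r ^ 4 - z ^ 2 / r ^ 3)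

theorem hasDerivAt_regG (z : ℂ) {r : ℝ} (hr : 0 < r) : HasDerivAt (regG z) (r * regG' z r) r := by
  have hr' : (r : ℂ) ≠ 0 := by exact_mod_cast hr.ne'
  have hpi : (Real.pi : ℂ) ≠ 0 := by exact_mod_cast Real.pi_ne_zero
  have h0 : HasDerivAt (fun w : ℂ => Complex.exp (Complex.I * z * w) / (4 * Real.pi * w))
      (r * regG' z r) (r : ℂ) := by
    have e1 := ((hasDerivAt_id (r : ℂ)).const_mul (Complex.I * z)).cexp
    have e2 := (hasDerivAt_id (r : ℂ)).const_mul (4 * Real.pi : ℂ)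
    have := e1.div e2 (by simp [hr', hpi])
    convert! this using 1
    unfold regG'
    simp
    field_simp
  exact h0.comp_ofReal

theorem hasDerivAt_regG' (z : ℂ) {r : ℝ} (hr : 0 < r) :
    HasDerivAt (regG' z) (r * regG'' z r) r := by
  have hr' : (r : ℂ) ≠ 0 := by exact_mod_cast hr.ne'
  have hpi : (Real.pi : ℂ) ≠ 0 := by exact_mod_cast Real.pi_ne_zero
  have h0 : HasDerivAt (fun w : ℂ => Complex.exp (Complex.I * z * w) / (4 * Real.pi) *
      (Complex.I * z / w ^ 2 - 1 / w ^ 3)) (r * regG'' z r) (r : ℂ) := by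
    have e1 := (((hasDerivAt_id (r : ℂ)).const_mul (Complex.I * z)).cexp).div_const (4 * Real.pi)
    have e2 := (hasDerivAt_const (r : ℂ) (Complex.I * z)).div (hasDerivAt_pow 2 (r : ℂ))
      (by simp [hr'])
    have e3 := (hasDerivAt_const (r : ℂ) (1 : ℂ)).div (hasDerivAt_pow 3 (r : ℂ)) (by simp [hr'])
    have := e1.mul (e2.sub e3)
    convert! this using 1
    unfold regG''
    simp
    field_simp
    ring_nf
    simp
    ring
  exact h0.comp_ofReal

theorem norm_exp_I_mul_le_one {z : ℂ} (hz : 0 ≤ z.im) {r : ℝ} (hr : 0 ≤ r) :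
    ‖Complex.exp (Complex.I * z * r)‖ ≤ 1 := by
  rw [Complex.norm_exp, Real.exp_le_one_iff]
  simp
  positivity

/-- The radial Helmholtz equation in dimension three. With `r² = a² + |y|²` it says that the
regularized kernel satisfies `(-Δ - z²)G = a² G''`, in the notation of `regG''`. -/
theorem three_mul_regG' (z : ℂ) {r : ℝ} (hr : 0 < r) :
    3 * regG' z r + r ^ 2 * regG'' z r = - z ^ 2 * regG z r := by
  have hr' : (r : ℂ) ≠ 0 := by exact_mod_cast hr.ne'
  have hpi : (Real.pi : ℂ) ≠ 0 := by exact_mod_cast Real.pi_ne_zero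
  unfold regG regG' regG''
  field_simp
  ring

theorem norm_inv_pow_le {a r : ℝ} (ha : 0 < a) (hr : a ≤ r) (n : ℕ) (c : ℂ) :
    ‖c / (r : ℂ) ^ n‖ ≤ ‖c‖ / a ^ n := by
  rw [norm_div, norm_pow, Complex.norm_real, Real.norm_of_nonneg (ha.le.trans hr)]
  gcongr

theorem norm_regG_le {z : ℂ} (hz : 0 ≤ z.im) {r : ℝ} (hr : 0 ≤ r) :
    ‖regG z r‖ ≤ (4 * Real.pi)⁻¹ * r⁻¹ := by
  unfold regG
  rw [norm_div]
  have : ‖(4 * Real.pi * r : ℂ)‖ = 4 * Real.pi * r := by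
    rw [← Complex.ofReal_ofNat, ← Complex.ofReal_mul, ← Complex.ofReal_mul, Complex.norm_real,
      Real.norm_of_nonneg (by positivity)]
  rw [this, ← mul_inv, div_eq_mul_inv]
  exact mul_le_of_le_one_left (by positivity) (norm_exp_I_mul_le_one hz hr)

theorem norm_exp_div_le {z : ℂ} (hz : 0 ≤ z.im) {r : ℝ} (hr : 0 ≤ r) :
    ‖Complex.exp (Complex.I * z * r) / (4 * Real.pi)‖ ≤ 1 := by
  rw [norm_div]
  have : ‖(4 * Real.pi : ℂ)‖ = 4 * Real.pi := by
    rw [← Complex.ofReal_ofNat, ← Complex.ofReal_mul, Complex.norm_real,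
      Real.norm_of_nonneg (by positivity)]
  rw [this]
  apply div_le_one_of_le₀ _ (by positivity)
  have := norm_exp_I_mul_le_one hz hr
  nlinarith [Real.pi_gt_three]

theorem exists_norm_regG'_le {z : ℂ} (hz : 0 ≤ z.im) {a : ℝ} (ha : 0 < a) :
    ∃ C, ∀ r, a ≤ r → ‖regG' z r‖ ≤ C := by
  refine ⟨1 * (‖Complex.I * z‖ / a ^ 2 + ‖(1 : ℂ)‖ / a ^ 3), fun r hr => ?_⟩
  unfold regG'
  rw [norm_mul]
  exact mul_le_mul (norm_exp_div_le hz (ha.le.trans hr)) ((norm_sub_le _ _).trans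
    (add_le_add (norm_inv_pow_le ha hr _ _) (norm_inv_pow_le ha hr _ _)))
    (norm_nonneg _) zero_le_one

theorem exists_norm_regG''_le {z : ℂ} (hz : 0 ≤ z.im) {a : ℝ} (ha : 0 < a) :
    ∃ C, ∀ r, a ≤ r → ‖regG'' z r‖ ≤ C := by
  refine ⟨1 * (‖(3 : ℂ)‖ / a ^ 5 + ‖3 * Complex.I * z‖ / a ^ 4 + ‖z ^ 2‖ / a ^ 3), fun r hr => ?_⟩
  unfold regG''
  rw [norm_mul]
  exact mul_le_mul (norm_exp_div_le hz (ha.le.trans hr)) ((norm_sub_le _ _).trans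
    (add_le_add ((norm_sub_le _ _).trans (add_le_add (norm_inv_pow_le ha hr _ _)
      (norm_inv_pow_le ha hr _ _))) (norm_inv_pow_le ha hr _ _))) (norm_nonneg _) zero_le_one

theorem integrable_comp_regNorm_mul {a : ℝ} (ha : 0 < a) {h : ℝ → ℂ}
    (hc : ContinuousOn h (Set.Ioi 0)) (hb : ∃ C, ∀ r, a ≤ r → ‖h r‖ ≤ C) (ψ : 𝓢(R3, ℂ)) :
    Integrable (fun y => h (regNorm a y) * ψ y) := by
  obtain ⟨C, hC⟩ := hb
  have hcont : Continuous (fun y => h (regNorm a y)) :=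
    hc.comp_continuous (continuous_regNorm a) (fun y => regNorm_pos ha y)
  exact ψ.integrable.bdd_mul hcont.aestronglyMeasurable
    (Filter.Eventually.of_forall fun y => hC _ (le_regNorm y))

theorem continuousOn_regG (z : ℂ) : ContinuousOn (regG z) (Set.Ioi 0) := fun _ hr =>
  (hasDerivAt_regG z hr).continuousAt.continuousWithinAt

theorem continuousOn_regG' (z : ℂ) : ContinuousOn (regG' z) (Set.Ioi 0) := fun _ hr =>
  (hasDerivAt_regG' z hr).continuousAt.continuousWithinAt

theorem continuousOn_regG'' (z : ℂ) : ContinuousOn (regG'' z) (Set.Ioi 0) := by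
  intro r hr
  have : (r : ℂ) ≠ 0 := by exact_mod_cast (ne_of_gt hr)
  unfold regG''
  apply ContinuousAt.continuousWithinAt
  refine ContinuousAt.mul (by fun_prop) ?_
  refine ((ContinuousAt.div₀ ?_ ?_ ?_).sub (ContinuousAt.div₀ ?_ ?_ ?_)).sub
    (ContinuousAt.div₀ ?_ ?_ ?_) <;> first | fun_prop | simpa using this

/-- Replacing `|y|` by `√(a² + |y|²)` makes the kernel smooth, so two integrations by parts are
legitimate without excising a ball; the point source becomes the spread-out source on the right. -/
theorem integral_regG_mul_helmholtz {z : ℂ} (hz : 0 ≤ z.im) {a : ℝ} (ha : 0 < a) (u : 𝓢(R3, ℂ)) :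
    ∫ y, regG z (regNorm a y) * helmholtz z u y =
      ∫ y, (a : ℂ) ^ 2 * regG'' z (regNorm a y) * u y := by
  have bG : ∃ C, ∀ r, a ≤ r → ‖regG z r‖ ≤ C := ⟨(4 * Real.pi)⁻¹ * a⁻¹, fun r hr =>
    (norm_regG_le hz (ha.le.trans hr)).trans (by gcongr)⟩
  have bG' := exists_norm_regG'_le hz ha
  have bG'' := exists_norm_regG''_le hz ha
  have iG := integrable_comp_regNorm_mul ha (continuousOn_regG z) bG
  have iG' := integrable_comp_regNorm_mul ha (continuousOn_regG' z) bG'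
  have iG'' := integrable_comp_regNorm_mul ha (continuousOn_regG'' z) bG''
  have cx : ∀ (i : Fin 3) (ψ : 𝓢(R3, ℂ)) (y : R3),
      SchwartzMap.smulLeftCLM ℂ (fun x : R3 => x i) ψ y = (y i : ℂ) * ψ y := by
    intro i ψ y
    rw [SchwartzMap.smulLeftCLM_apply_apply (by fun_prop)]; simp
  have iG1 : ∀ (i : Fin 3) (ψ : 𝓢(R3, ℂ)),
      Integrable (fun y : R3 => (y i : ℂ) * regG' z (regNorm a y) * ψ y) := by
    intro i ψ
    refine (iG' (SchwartzMap.smulLeftCLM ℂ (fun x : R3 => x i) ψ)).congr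
      (Filter.Eventually.of_forall fun y => ?_)
    simp only [cx]; ring
  have iG2 : ∀ (i : Fin 3) (ψ : 𝓢(R3, ℂ)), Integrable (fun y : R3 => (regG' z (regNorm a y) +
      (y i : ℂ) ^ 2 * regG'' z (regNorm a y)) * ψ y) := by
    intro i ψ
    refine ((iG' ψ).add (iG'' (SchwartzMap.smulLeftCLM ℂ (fun x : R3 => x i)
      (SchwartzMap.smulLeftCLM ℂ (fun x : R3 => x i) ψ)))).congr
      (Filter.Eventually.of_forall fun y => ?_)
    simp only [cx, Pi.add_apply]; ring
  have d1 : ∀ (i : Fin 3) (y : R3), HasLineDerivAt ℝ (fun y => regG z (regNorm a y))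
      ((y i : ℂ) * regG' z (regNorm a y)) y (unitVec i) := fun i y =>
    hasLineDerivAt_comp_regNorm ha i y (hasDerivAt_regG z (regNorm_pos ha y))
  have d2 : ∀ (i : Fin 3) (y : R3), HasLineDerivAt ℝ
      (fun y : R3 => (y i : ℂ) * regG' z (regNorm a y))
      (regG' z (regNorm a y) + (y i : ℂ) ^ 2 * regG'' z (regNorm a y)) y (unitVec i) := by
    intro i y
    have e1 := hasLineDerivAt_comp_regNorm ha i y (hasDerivAt_regG' z (regNorm_pos ha y))
    have e2 := hasLineDerivAt_coord i i y
    unfold HasLineDerivAt at e1 e2 ⊢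
    have e3 := e2.ofReal_comp
    convert! e3.mul e1 using 1
    simp; ring
  have key : ∀ i : Fin 3, ∫ y, regG z (regNorm a y) * partialD i (partialD i u) y =
      ∫ y : R3, (regG' z (regNorm a y) + (y i : ℂ) ^ 2 * regG'' z (regNorm a y)) * u y := by
    intro i
    have s1 := integral_bilinear_hasLineDerivAt_right_eq_neg_left_of_integrable (μ := volume)
      (B := ContinuousLinearMap.mul ℝ ℂ) (v := unitVec i)
      (iG1 i (partialD i u)) (iG (partialD i (partialD i u)))
      (iG (partialD i u)) (fun y _ => d1 i y)
      (fun y _ => hasLineDerivAt_schwartz (partialD i u) y i)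
    have s2 := integral_bilinear_hasLineDerivAt_right_eq_neg_left_of_integrable (μ := volume)
      (B := ContinuousLinearMap.mul ℝ ℂ) (v := unitVec i)
      (iG2 i u) (iG1 i (partialD i u)) (iG1 i u) (fun y _ => d2 i y)
      (fun y _ => hasLineDerivAt_schwartz u y i)
    simp only [ContinuousLinearMap.mul_apply'] at s1 s2
    rw [s1, s2, neg_neg]
  have e1 : ∫ y, regG z (regNorm a y) * helmholtz z u y =
      - (∑ i, ∫ y, regG z (regNorm a y) * partialD i (partialD i u) y)
        - z ^ 2 * ∫ y, regG z (regNorm a y) * u y := by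
    rw [← integral_const_mul,
      ← integral_finsetSum _ fun i _ => iG (partialD i (partialD i u)), ← integral_neg,
      ← integral_sub (integrable_finsetSum _ fun i _ => iG (partialD i (partialD i u))).fun_neg
        ((iG u).const_mul _)]
    congr 1; ext y
    unfold helmholtz
    rw [laplacian_eq_sum_partialD]
    simp [Fin.sum_univ_three]
    ring
  rw [e1]
  simp only [key]
  rw [← integral_const_mul, ← integral_finsetSum _ fun i _ => iG2 i u, ← integral_neg,
      ← integral_sub (integrable_finsetSum _ fun i _ => iG2 i u).fun_neg ((iG u).const_mul _)]
  congr 1; ext y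
  have h3 := three_mul_regG' z (regNorm_pos ha y)
  have h4 : (regNorm a y : ℂ) ^ 2
      = (a : ℂ) ^ 2 + ((y 0 : ℂ) ^ 2 + (y 1 : ℂ) ^ 2 + (y 2 : ℂ) ^ 2) := by
    have := regNorm_sq a y
    rw [norm_sq_eq_sum] at this
    exact_mod_cast this
  rw [h4] at h3
  simp only [Fin.sum_univ_three]
  linear_combination (-u y) * h3

theorem regNorm_smul {a : ℝ} (ha : 0 < a) (w : R3) : regNorm a (a • w) = a * jb 1 w := by
  rw [jb_one, regNorm, norm_smul, Real.norm_of_nonneg ha.le,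
    show a ^ 2 + (a * ‖w‖) ^ 2 = a ^ 2 * (1 + ‖w‖ ^ 2) by ring,
    Real.sqrt_mul (by positivity), Real.sqrt_sq ha.le]

/-- The rescaled source term of the regularized kernel. -/
def scaledSource (z : ℂ) (a : ℝ) (w : R3) : ℂ :=
  Complex.exp (Complex.I * z * (a * jb 1 w : ℝ)) / (4 * Real.pi) *
    (3 * jb (-5) w - 3 * Complex.I * z * a * jb (-4) w - z ^ 2 * a ^ 2 * jb (-3) w)

theorem jb_neg_nat (n : ℕ) (w : R3) : jb (-n) w = (jb 1 w ^ n)⁻¹ := by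
  unfold jb
  rw [← Real.rpow_natCast _ n, ← Real.rpow_mul (by positivity), ← Real.rpow_neg (by positivity)]
  congr 1; ring

/-- The factor `a³` is the Jacobian of `y = a w`. At this scale the source has the pointwise limit
`3/(4π) ⟨w⟩⁻⁵` as `a → 0`, whose integral is one. -/
theorem scaledSource_eq (z : ℂ) {a : ℝ} (ha : 0 < a) (w : R3) :
    (a : ℂ) ^ 3 * ((a : ℂ) ^ 2 * regG'' z (regNorm a (a • w))) = scaledSource z a w := by
  rw [regNorm_smul ha]
  unfold regG'' scaledSource
  have h5 := jb_neg_nat 5 w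
  have h4 := jb_neg_nat 4 w
  have h3 := jb_neg_nat 3 w
  norm_num at h5 h4 h3
  rw [h5, h4, h3]
  have ha' : (a : ℂ) ≠ 0 := by exact_mod_cast ha.ne'
  have hj : (jb 1 w : ℂ) ≠ 0 := by exact_mod_cast (jb_pos 1 w).ne'
  have hpi : (Real.pi : ℂ) ≠ 0 := by exact_mod_cast Real.pi_ne_zero
  push_cast
  field_simp

theorem integral_source_eq {z : ℂ} {a : ℝ} (ha : 0 < a) (u : 𝓢(R3, ℂ)) :
    ∫ y, (a : ℂ) ^ 2 * regG'' z (regNorm a y) * u y = ∫ w, scaledSource z a w * u (a • w) := by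
  have h := Measure.integral_comp_smul (volume : Measure R3)
    (fun y => (a : ℂ) ^ 3 * ((a : ℂ) ^ 2 * regG'' z (regNorm a y) * u y)) a
  have e : ∀ w, (a : ℂ) ^ 3 * ((a : ℂ) ^ 2 * regG'' z (regNorm a (a • w)) * u (a • w))
      = scaledSource z a w * u (a • w) := by
    intro w; rw [← scaledSource_eq z ha]; ring
  simp only [e] at h
  rw [h, integral_const_mul]
  have ha' : (a : ℂ) ≠ 0 := by exact_mod_cast ha.ne'
  have : |(a ^ Module.finrank ℝ R3)⁻¹| = (a ^ 3)⁻¹ := by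
    rw [abs_of_pos (by positivity)]; simp
  rw [this, Complex.real_smul]
  push_cast
  rw [← mul_assoc, inv_mul_cancel₀ (by positivity), one_mul]

/-- The last term of the source decays only like `⟨w⟩⁻³`, which is not integrable. The exponential
decay supplied by `Im z > 0` trades a factor `a⟨w⟩` for `1/Im z`, giving a majorant independent of
`a`. -/
theorem norm_scaledSource_le {z : ℂ} (hz : 0 < z.im) {a : ℝ} (ha : 0 < a) (ha1 : a ≤ 1) (w : R3) :
    ‖scaledSource z a w‖ ≤ (3 + 3 * ‖z‖ + ‖z‖ ^ 2 / z.im) * jb (-4) w := by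
  have j1 := jb_pos 1 w
  have hE1 := norm_exp_div_le hz.le (by positivity : 0 ≤ a * jb 1 w)
  set E := Complex.exp (Complex.I * z * (a * jb 1 w : ℝ)) / (4 * Real.pi) with hE
  have hE2 : ‖E‖ * (a * jb 1 w) ≤ 1 / z.im := by
    rw [hE, norm_div, Complex.norm_exp]
    have hp : ‖(4 * Real.pi : ℂ)‖ = 4 * Real.pi := by
      rw [← Complex.ofReal_ofNat, ← Complex.ofReal_mul, Complex.norm_real,
        Real.norm_of_nonneg (by positivity)]
    rw [hp]
    have hr : (Complex.I * z * (a * jb 1 w : ℝ)).re = - (z.im * (a * jb 1 w)) := by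
      rw [Complex.re_mul_ofReal]; simp
    rw [hr]
    set t := z.im * (a * jb 1 w) with ht
    have ht0 : 0 ≤ t := by positivity
    have h1 : t * Real.exp (-t) ≤ 1 := by
      rw [Real.exp_neg, ← div_eq_mul_inv]
      apply div_le_one_of_le₀ _ (Real.exp_pos _).le
      linarith [Real.add_one_le_exp t]
    have h2 : a * jb 1 w = t / z.im := by rw [ht]; field_simp
    rw [h2]
    calc Real.exp (-t) / (4 * Real.pi) * (t / z.im)
        = (t * Real.exp (-t)) / z.im * (4 * Real.pi)⁻¹ := by field_simp
      _ ≤ 1 / z.im * 1 := by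
          gcongr
          apply inv_le_one_of_one_le₀; nlinarith [Real.pi_gt_three]
      _ = _ := by ring
  have j5 : jb (-5) w ≤ jb (-4) w := jb_mono (by norm_num) w
  have j3 : jb (-3) w = jb 1 w * jb (-4) w := by rw [← jb_add]; norm_num
  have j4 := jb_pos (-4) w
  have j5' := jb_pos (-5) w
  unfold scaledSource
  rw [norm_mul, ← hE]
  have hs : ‖3 * (jb (-5) w : ℂ) - 3 * Complex.I * z * a * jb (-4) w - z ^ 2 * a ^ 2 * jb (-3) w‖
      ≤ 3 * jb (-5) w + 3 * ‖z‖ * a * jb (-4) w + ‖z‖ ^ 2 * a ^ 2 * (jb 1 w * jb (-4) w) := by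
    refine (norm_sub_le _ _).trans (add_le_add ((norm_sub_le _ _).trans (add_le_add ?_ ?_)) ?_)
    · simp [abs_of_pos j5']
    · simp [abs_of_pos j4, abs_of_pos ha]
    · rw [j3]; simp [abs_of_pos j4, abs_of_pos ha, abs_of_pos j1]
  calc _ ≤ ‖E‖ * _ := mul_le_mul_of_nonneg_left hs (norm_nonneg _)
    _ = ‖E‖ * (3 * jb (-5) w + 3 * ‖z‖ * a * jb (-4) w)
        + ‖z‖ ^ 2 * a * (‖E‖ * (a * jb 1 w)) * jb (-4) w := by ring
    _ ≤ 1 * (3 * jb (-4) w + 3 * ‖z‖ * 1 * jb (-4) w) + ‖z‖ ^ 2 * 1 * (1 / z.im) * jb (-4) w := by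
        gcongr
    _ = _ := by ring

theorem tendsto_integral_source {z : ℂ} (hz : 0 < z.im) (u : 𝓢(R3, ℂ)) {a : ℕ → ℝ}
    (ha : ∀ n, 0 < a n) (ha1 : ∀ n, a n ≤ 1) (hlim : Filter.Tendsto a Filter.atTop (nhds 0)) :
    Filter.Tendsto (fun n => ∫ y, (a n : ℂ) ^ 2 * regG'' z (regNorm (a n) y) * u y)
      Filter.atTop (nhds (u 0)) := by
  simp only [fun n => integral_source_eq (z := z) (ha n) u]
  have hval : ∫ w : R3, (3 / (4 * Real.pi) * (jb (-5) w : ℂ)) * u 0 = u 0 := by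
    rw [integral_mul_const, integral_const_mul, integral_complex_ofReal, integral_jb_neg_five]
    have hpi : (Real.pi : ℂ) ≠ 0 := by exact_mod_cast Real.pi_ne_zero
    push_cast
    field_simp
  rw [← hval]
  obtain ⟨M, hM0, hM⟩ := exists_le_jb u 0
  refine tendsto_integral_of_dominated_convergence
    (fun w => (3 + 3 * ‖z‖ + ‖z‖ ^ 2 / z.im) * jb (-4) w * M) ?_ ?_ ?_ ?_
  · intro n
    refine Continuous.aestronglyMeasurable ?_
    have := continuous_jb
    unfold scaledSource
    have := u.continuous
    fun_prop
  · exact ((integrable_jb (by norm_num)).const_mul _).mul_const _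
  · intro n
    refine Filter.Eventually.of_forall fun w => ?_
    rw [norm_mul]
    have h1 := norm_scaledSource_le hz (ha n) (ha1 n) w
    have h2 := hM (a n • w)
    rw [neg_zero, jb_zero, mul_one] at h2
    exact mul_le_mul h1 h2 (norm_nonneg _) ((norm_nonneg _).trans h1)
  · refine Filter.Eventually.of_forall fun w => ?_
    have hc : Continuous (fun t : ℝ => scaledSource z t w * u (t • w)) := by
      unfold scaledSource
      have := u.continuous
      fun_prop
    have := (hc.tendsto 0).comp hlim
    convert! this using 2
    unfold scaledSource
    simp
    left; ring

theorem tendsto_integral_regG {z : ℂ} (hz : 0 ≤ z.im) (f : 𝓢(R3, ℂ)) {a : ℕ → ℝ}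
    (ha : ∀ n, 0 < a n) (hlim : Filter.Tendsto a Filter.atTop (nhds 0)) :
    Filter.Tendsto (fun n => ∫ y, regG z (regNorm (a n) y) * f y)
      Filter.atTop (nhds (∫ y, regG z ‖y‖ * f y)) := by
  obtain ⟨C, -, hC⟩ := exists_integral_inv_norm_mul_schwartz_le f
  refine tendsto_integral_of_dominated_convergence
    (fun y => (4 * Real.pi)⁻¹ * (‖y - 0‖⁻¹ * ‖f y‖)) ?_ ((hC 0).1.const_mul _) ?_ ?_
  · intro n
    exact (integrable_comp_regNorm_mul (ha n) (continuousOn_regG z)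
      ⟨(4 * Real.pi)⁻¹ * (a n)⁻¹, fun r hr => (norm_regG_le hz ((ha n).le.trans hr)).trans
        (by have := ha n; gcongr)⟩ f).aestronglyMeasurable
  · intro n
    have h0 : ∀ᵐ y : R3, y ≠ 0 := by simp [ae_iff]
    filter_upwards [h0] with y hy
    rw [norm_mul, sub_zero, ← mul_assoc]
    gcongr
    refine (norm_regG_le hz (regNorm_pos (ha n) y).le).trans ?_
    have : 0 < ‖y‖ := norm_pos_iff.2 hy
    gcongr
    exact norm_le_regNorm _ _
  · have h0 : ∀ᵐ y : R3, y ≠ 0 := by simp [ae_iff]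
    filter_upwards [h0] with y hy
    refine Filter.Tendsto.mul_const _ ?_
    have h1 : ContinuousAt (regG z) ‖y‖ := (hasDerivAt_regG z (norm_pos_iff.2 hy)).continuousAt
    refine h1.tendsto.comp ?_
    have h2 : Continuous (fun t : ℝ => regNorm t y) := by unfold regNorm; fun_prop
    have := (h2.tendsto 0).comp hlim
    convert! this using 2
    simp [regNorm]

theorem green_at_zero {z : ℂ} (hz : 0 < z.im) (u : 𝓢(R3, ℂ)) :
    ∫ y, regG z ‖y‖ * helmholtz z u y = u 0 := by
  have hlim : Filter.Tendsto (fun n : ℕ => (1 / ((n : ℝ) + 1))) Filter.atTop (nhds 0) :=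
    tendsto_one_div_add_atTop_nhds_zero_nat
  have hpos : ∀ n : ℕ, 0 < (1 / ((n : ℝ) + 1)) := fun n => by positivity
  have h1 := tendsto_integral_regG hz.le (helmholtz z u) hpos hlim
  have h2 := tendsto_integral_source hz u hpos (fun n => by
    apply div_le_one_of_le₀ <;> linarith [(n.cast_nonneg : (0 : ℝ) ≤ n)]) hlim
  simp only [fun n => integral_regG_mul_helmholtz hz.le (hpos n) u] at h1
  exact tendsto_nhds_unique h1 h2

theorem partialD_translate (i : Fin 3) (u : 𝓢(R3, ℂ)) (x : R3) :
    partialD i (SchwartzMap.compSubConstCLM ℂ x u) =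
      SchwartzMap.compSubConstCLM ℂ x (partialD i u) := by
  ext y
  have h1 := hasLineDerivAt_schwartz (SchwartzMap.compSubConstCLM ℂ x u) y i
  have h2 := hasLineDerivAt_schwartz u (y - x) i
  refine h1.unique ?_
  unfold HasLineDerivAt at h2 ⊢
  simp only [SchwartzMap.compSubConstCLM_apply]
  convert! h2 using 3
  abel

/-- Green's representation formula for the Helmholtz operator. -/
theorem green_representation {z : ℂ} (hz : 0 < z.im) (u : 𝓢(R3, ℂ)) (x : R3) :
    ∫ y, regG z ‖x - y‖ * helmholtz z u y = u x := by
  have h := green_at_zero hz (SchwartzMap.compSubConstCLM ℂ (-x) u)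
  have h1 : helmholtz z (SchwartzMap.compSubConstCLM ℂ (-x) u) =
      SchwartzMap.compSubConstCLM ℂ (-x) (helmholtz z u) := by
    unfold helmholtz
    simp only [laplacian_eq_sum_partialD, partialD_translate, map_sub, map_neg, map_sum, map_smul]
  rw [h1] at h
  simp only [SchwartzMap.compSubConstCLM_apply, sub_neg_eq_add, zero_add] at h
  rw [← h, ← integral_add_right_eq_self _ x]
  congr 1; ext y
  rw [show x - (y + x) = -y by abel, norm_neg]

/-! ### The resolvent off the real axis as a Fourier multiplier on Schwartz functions. -/

theorem iteratedDeriv_inv_sub {c : ℂ} (hc : c.im ≠ 0) (n : ℕ) :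
    iteratedDeriv n (fun t : ℝ => ((t : ℂ) - c)⁻¹) =
      fun t : ℝ => (-1) ^ n * (n.factorial : ℂ) * (((t : ℂ) - c) ^ (n + 1))⁻¹ := by
  have hne : ∀ t : ℝ, (t : ℂ) - c ≠ 0 := by
    intro t h
    apply hc
    have := congrArg Complex.im h
    simpa using this
  induction n with
  | zero => ext t; simp
  | succ n ih =>
    rw [iteratedDeriv_succ, ih]
    ext t
    have h1 : HasDerivAt (fun w : ℂ => (-1) ^ n * (n.factorial : ℂ) * ((w - c) ^ (n + 1))⁻¹)
        ((-1) ^ (n + 1) * ((n + 1).factorial : ℂ) * (((t : ℂ) - c) ^ (n + 1 + 1))⁻¹) (t : ℂ) := by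
      have a := ((hasDerivAt_id (t : ℂ)).sub_const c).pow (n + 1)
      have b := (a.inv (pow_ne_zero _ (hne t))).const_mul ((-1) ^ n * (n.factorial : ℂ))
      convert! b using 1
      have := hne t
      rw [Nat.factorial_succ]
      simp only [id, Nat.add_sub_cancel, Pi.pow_apply]
      push_cast
      field_simp
      ring
    exact h1.comp_ofReal.deriv

theorem inv_sub_hasTemperateGrowth {c : ℂ} (hc : c.im ≠ 0) :
    (fun t : ℝ => ((t : ℂ) - c)⁻¹).HasTemperateGrowth := by
  have hne : ∀ t : ℝ, (t : ℂ) - c ≠ 0 := by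
    intro t h
    apply hc
    have := congrArg Complex.im h
    simpa using this
  refine ⟨?_, fun n => ⟨0, n.factorial * (|c.im| ^ (n + 1))⁻¹, fun t => ?_⟩⟩
  · exact ContDiff.inv (Complex.ofRealCLM.contDiff.sub contDiff_const) hne
  · rw [norm_iteratedFDeriv_eq_norm_iteratedDeriv, iteratedDeriv_inv_sub hc]
    simp only [norm_mul, norm_pow, norm_neg, norm_one, one_pow, one_mul, pow_zero, mul_one,
      norm_inv, Complex.norm_natCast]
    have h1 : 0 < |c.im| := abs_pos.2 hc
    have h2 : |c.im| ≤ ‖(t : ℂ) - c‖ := by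
      have := Complex.abs_im_le_norm ((t : ℂ) - c)
      simpa using this
    gcongr

/-- The symbol `1 / (|2πξ|² - z²)` of the resolvent of `-Δ`. -/
def resolventSymbol (z : ℂ) (ξ : R3) : ℂ := (((‖(2 * Real.pi) • ξ‖ ^ 2 : ℝ) : ℂ) - z ^ 2)⁻¹

theorem resolventSymbol_hasTemperateGrowth {z : ℂ} (hz : (z ^ 2).im ≠ 0) :
    (resolventSymbol z).HasTemperateGrowth := by
  have h : (fun ξ : R3 => ‖(2 * Real.pi) • ξ‖ ^ 2).HasTemperateGrowth := by
    have : (fun ξ : R3 => ‖(2 * Real.pi) • ξ‖ ^ 2) = fun ξ => (2 * Real.pi) ^ 2 * ‖ξ‖ ^ 2 := by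
      ext ξ; rw [norm_smul, mul_pow, Real.norm_of_nonneg (by positivity)]
    rw [this]; fun_prop
  exact (inv_sub_hasTemperateGrowth hz).comp h

/-- The resolvent `(-Δ - z²)⁻¹` on Schwartz functions. -/
def resolventS (z : ℂ) : 𝓢(R3, ℂ) →L[ℂ] 𝓢(R3, ℂ) :=
  SchwartzMap.fourierMultiplierCLM ℂ (resolventSymbol z)

/-- The operator `(I - Δ)^(s/2)` on Schwartz functions. -/
def besselS (s : ℝ) : 𝓢(R3, ℂ) →L[ℂ] 𝓢(R3, ℂ) :=
  SchwartzMap.fourierMultiplierCLM ℂ (laplaceSymbol s)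

/-- Multiplication by `⟨x⟩^δ` on Schwartz functions. -/
def weightS (δ : ℝ) : 𝓢(R3, ℂ) →L[ℂ] 𝓢(R3, ℂ) :=
  SchwartzMap.smulLeftCLM ℂ (bracketPow δ)

theorem bracketPow_eq (δ : ℝ) (x : R3) : bracketPow δ x = (jb δ x : ℂ) := rfl

theorem weightS_apply (δ : ℝ) (f : 𝓢(R3, ℂ)) (x : R3) : weightS δ f x = (jb δ x : ℂ) * f x := by
  unfold weightS
  rw [SchwartzMap.smulLeftCLM_apply_apply (bracketPow_hasTemperateGrowth δ)]; rfl

theorem fourier_multiplier_apply {g : R3 → ℂ} (hg : g.HasTemperateGrowth) (f : 𝓢(R3, ℂ)) (ξ : R3) :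
    𝓕 (SchwartzMap.fourierMultiplierCLM ℂ g f) ξ = g ξ * 𝓕 f ξ := by
  rw [SchwartzMap.fourierMultiplierCLM_apply, FourierTransform.fourier_fourierInv_eq,
    SchwartzMap.smulLeftCLM_apply_apply hg]; rfl

theorem schwartz_ext_fourier {f g : 𝓢(R3, ℂ)} (h : ∀ ξ, 𝓕 f ξ = 𝓕 g ξ) : f = g := by
  have : 𝓕 f = 𝓕 g := SchwartzMap.ext h
  exact (FourierTransform.fourierCLE ℂ 𝓢(R3, ℂ)).injective this

theorem fourier_helmholtz (z : ℂ) (u : 𝓢(R3, ℂ)) (ξ : R3) :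
    𝓕 (helmholtz z u) ξ = (((‖(2 * Real.pi) • ξ‖ ^ 2 : ℝ) : ℂ) - z ^ 2) * 𝓕 u ξ := by
  have h1 : helmholtz z u = ((((2 * Real.pi) ^ 2 : ℝ) : ℂ)) •
      SchwartzMap.fourierMultiplierCLM ℂ (fun x : R3 => ((‖x‖ ^ 2 : ℝ) : ℂ)) u + (- z ^ 2) • u := by
    unfold helmholtz
    rw [SchwartzMap.laplacian_eq_fourierMultiplierCLM,
      ← SchwartzMap.fourierMultiplierCLM_ofReal ℂ (by fun_prop)]
    ext x
    simp
    ring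
  rw [h1, FourierTransform.fourier_add, FourierTransform.fourier_smul,
    FourierTransform.fourier_smul, _root_.add_apply, _root_.smul_apply,
    _root_.smul_apply, fourier_multiplier_apply (by fun_prop), norm_smul, mul_pow,
    Real.norm_of_nonneg (by positivity)]
  simp
  ring

theorem sub_sq_ne_zero {z : ℂ} (hz : (z ^ 2).im ≠ 0) (t : ℝ) : (t : ℂ) - z ^ 2 ≠ 0 := by
  intro h
  apply hz
  have := congrArg Complex.im h
  simpa using this

theorem helmholtz_resolventS {z : ℂ} (hz : (z ^ 2).im ≠ 0) (f : 𝓢(R3, ℂ)) :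
    helmholtz z (resolventS z f) = f := by
  apply schwartz_ext_fourier
  intro ξ
  rw [fourier_helmholtz, resolventS,
    fourier_multiplier_apply (resolventSymbol_hasTemperateGrowth hz),
    resolventSymbol, ← mul_assoc, mul_inv_cancel₀ (sub_sq_ne_zero hz _), one_mul]

/-- Green's formula applied to `u = resolventS z f`, which is Schwartz because the symbol has no
real singularity. -/
theorem resolventS_apply {k η : ℝ} (hk : 0 < k) (hη : 0 < η) (f : 𝓢(R3, ℂ)) (x : R3) :
    resolventS (k + η * Complex.I) f x = ∫ y, regG (k + η * Complex.I) ‖x - y‖ * f y := by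
  have him : ((k + η * Complex.I : ℂ) ^ 2).im ≠ 0 := by
    have : ((k + η * Complex.I : ℂ) ^ 2).im = 2 * k * η := by simp [sq]; ring
    rw [this]; positivity
  rw [← green_representation (z := k + η * Complex.I) (by simpa using hη)
    (resolventS (k + η * Complex.I) f) x,
    helmholtz_resolventS him]

/-! ### From the weighted `L²` estimate to the weighted Sobolev estimate. -/

/-- By scaling to `y = 1`, it suffices that `r^s` lies between `1` and `r`. The factor depends on
`y` alone, so the bound holds even for `x` near zero. -/
theorem abs_rpow_sub_rpow_le {s x y : ℝ} (hs : 0 ≤ s) (hs1 : s ≤ 1) (hx : 0 ≤ x) (hy : 0 < y) :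
    |x ^ s - y ^ s| ≤ y ^ (s - 1) * |x - y| := by
  have hxy : x = y * (x / y) := by field_simp
  set r := x / y with hr
  have hr0 : 0 ≤ r := by positivity
  have h1 : |r ^ s - 1| ≤ |r - 1| := by
    rcases le_total r 1 with h | h
    · have h2 : r ≤ r ^ s := by
        rcases hr0.eq_or_lt with h0 | h0
        · rw [← h0]; positivity
        · simpa using Real.rpow_le_rpow_of_exponent_ge h0 h hs1
      have h3 : r ^ s ≤ 1 := Real.rpow_le_one hr0 h hs
      rw [abs_of_nonpos (by linarith), abs_of_nonpos (by linarith)]; linarith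
    · have h2 : r ^ s ≤ r := by
        simpa using Real.rpow_le_rpow_of_exponent_le h hs1
      have h3 : 1 ≤ r ^ s := Real.one_le_rpow h hs
      rw [abs_of_nonneg (by linarith), abs_of_nonneg (by linarith)]; linarith
  have e1 : x ^ s - y ^ s = y ^ s * (r ^ s - 1) := by
    rw [hxy, Real.mul_rpow hy.le hr0]; ring
  have e2 : x - y = y * (r - 1) := by rw [hxy]; ring
  have e3 : y ^ s = y ^ (s - 1) * y := by rw [← Real.rpow_add_one hy.ne']; ring_nf
  rw [e1, e2, abs_mul, abs_mul, abs_of_pos (by positivity : 0 < y ^ s), abs_of_pos hy, e3]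
  calc _ ≤ y ^ (s - 1) * y * |r - 1| := by gcongr
    _ = _ := by ring

/-- The numerator is bounded by a multiple of `|t - k²|`, and `|t - k²| ≤ |t - (k² - η²)| + η²`. The
denominator controls the first summand by its real part and, since `η² ≤ 2kη`, the second by its
imaginary part. -/
theorem symbol_difference_le {s k η : ℝ} (hs : 0 ≤ s) (hs1 : s ≤ 1) (hk : 2 < k) (hη : 0 < η)
    (hη1 : η ≤ 1) {t : ℝ} (ht : 0 ≤ t) :
    ‖((((1 + t) ^ s - (1 + k ^ 2) ^ s : ℝ)) : ℂ) * ((t : ℂ) - (k + η * Complex.I) ^ 2)⁻¹‖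
      ≤ 2 * k ^ (2 * s - 2) := by
  set w : ℂ := (t : ℂ) - (k + η * Complex.I) ^ 2 with hw
  have hre : w.re = t - (k ^ 2 - η ^ 2) := by simp [hw, sq]
  have him : w.im = - (2 * k * η) := by simp [hw, sq]; ring
  have h1 : 2 * k * η ≤ ‖w‖ := by
    have := Complex.abs_im_le_norm w
    rw [him, abs_neg, abs_of_pos (by positivity)] at this; exact this
  have h2 : |t - (k ^ 2 - η ^ 2)| ≤ ‖w‖ := by rw [← hre]; exact Complex.abs_re_le_norm w
  have hwpos : 0 < ‖w‖ := lt_of_lt_of_le (by positivity) h1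
  have h3 : |t - k ^ 2| ≤ 2 * ‖w‖ := by
    have : t - k ^ 2 = (t - (k ^ 2 - η ^ 2)) - η ^ 2 := by ring
    rw [this]
    refine (abs_sub _ _).trans ?_
    rw [abs_of_nonneg (sq_nonneg η)]
    nlinarith
  have h4 := abs_rpow_sub_rpow_le hs hs1 (by positivity : 0 ≤ 1 + t)
    (by positivity : 0 < 1 + k ^ 2)
  have h5 : (1 + t) - (1 + k ^ 2) = t - k ^ 2 := by ring
  rw [h5] at h4
  have h6 : (1 + k ^ 2) ^ (s - 1) ≤ k ^ (2 * s - 2) := by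
    have : k ^ (2 * s - 2) = (k ^ 2) ^ (s - 1) := by
      rw [← Real.rpow_natCast k 2, ← Real.rpow_mul (by linarith)]; congr 1; push_cast; ring
    rw [this]
    exact Real.rpow_le_rpow_of_nonpos (by positivity) (by linarith) (by linarith)
  rw [norm_mul, norm_inv, Complex.norm_real, Real.norm_eq_abs, ← div_eq_mul_inv,
    div_le_iff₀ hwpos]
  calc _ ≤ _ := h4
    _ ≤ k ^ (2 * s - 2) * (2 * ‖w‖) := by gcongr
    _ = _ := by ring

/-- The `L²` norm of a Schwartz function. -/
def l2norm (f : 𝓢(R3, ℂ)) : ℝ := ‖f.toLp 2 (volume : Measure R3)‖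

theorem l2norm_nonneg (f : 𝓢(R3, ℂ)) : 0 ≤ l2norm f := norm_nonneg _

theorem l2norm_add_le (f g : 𝓢(R3, ℂ)) : l2norm (f + g) ≤ l2norm f + l2norm g :=
  norm_add_le (f.toLp 2 (volume : Measure R3)) (g.toLp 2 (volume : Measure R3))

theorem l2norm_le_mul {f g : 𝓢(R3, ℂ)} {c : ℝ} (h : ∀ x, ‖f x‖ ≤ c * ‖g x‖) :
    l2norm f ≤ c * l2norm g := by
  unfold l2norm
  apply Lp.norm_le_mul_norm_of_ae_le_mul
  filter_upwards [f.coeFn_toLp 2 volume, g.coeFn_toLp 2 volume] with x hf hg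
  rw [hf, hg]; exact h x

theorem l2norm_fourier (f : 𝓢(R3, ℂ)) : l2norm (𝓕 f) = l2norm f :=
  SchwartzMap.norm_fourier_toL2_eq f

theorem l2norm_sq (f : 𝓢(R3, ℂ)) : l2norm f ^ 2 = ∫ x, ‖f x‖ ^ 2 := by
  have h := SchwartzMap.inner_toL2_toL2_eq f f (volume : Measure R3)
  rw [inner_self_eq_norm_sq_to_K] at h
  have h2 : ∫ x, inner ℂ (f x) (f x) = ((∫ x, ‖f x‖ ^ 2 : ℝ) : ℂ) := by
    rw [← integral_complex_ofReal]
    congr 1; ext x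
    rw [inner_self_eq_norm_sq_to_K]; simp
  rw [h2] at h
  unfold l2norm
  apply Complex.ofReal_injective
  rw [← h]; push_cast; rfl

theorem l2norm_weightS_sq (δ : ℝ) (f : 𝓢(R3, ℂ)) :
    l2norm (weightS δ f) ^ 2 = sqInt (jb (2 * δ)) f := by
  rw [l2norm_sq]
  unfold sqInt
  congr 1; ext x
  rw [weightS_apply, norm_mul, mul_pow, Complex.norm_real, Real.norm_of_nonneg (jb_pos _ _).le,
    sq (jb δ x), ← jb_add, two_mul]

theorem besselS_resolventS_besselS (s : ℝ) {z : ℂ} (hz : (z ^ 2).im ≠ 0) (c : ℝ) (f : 𝓢(R3, ℂ))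
    (ξ : R3) :
    𝓕 (besselS s (resolventS z (besselS s f)) - (c : ℂ) • resolventS z f) ξ =
      (((1 + ‖(2 * Real.pi) • ξ‖ ^ 2) ^ s - c : ℝ) : ℂ) *
        (((‖(2 * Real.pi) • ξ‖ ^ 2 : ℝ) : ℂ) - z ^ 2)⁻¹ * 𝓕 f ξ := by
  rw [sub_eq_add_neg, ← neg_smul, FourierTransform.fourier_add, FourierTransform.fourier_smul,
    _root_.add_apply, _root_.smul_apply]
  unfold besselS resolventS
  rw [fourier_multiplier_apply (laplaceSymbol_hasTemperateGrowth s),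
    fourier_multiplier_apply (resolventSymbol_hasTemperateGrowth hz),
    fourier_multiplier_apply (laplaceSymbol_hasTemperateGrowth s),
    fourier_multiplier_apply (resolventSymbol_hasTemperateGrowth hz)]
  have h : laplaceSymbol s ξ * laplaceSymbol s ξ
      = (((1 + ‖(2 * Real.pi) • ξ‖ ^ 2) ^ s : ℝ) : ℂ) := by
    unfold laplaceSymbol
    rw [bracketPow_eq, ← Complex.ofReal_mul, ← jb_add]
    unfold jb
    congr 2; ring
  rw [Complex.ofReal_sub, ← h]
  unfold resolventSymbol
  simp only [smul_eq_mul]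
  ring

/-- The uniform weighted Sobolev bound for the resolvent on Schwartz functions. -/
theorem l2norm_sandwich_le {s ε δ e k η : ℝ} (hs : 0 ≤ s) (hs1 : s ≤ 1) (hδ : δ = 1 / 2 + ε)
    (he : 0 < e) (he' : e ≤ 1 / 5) (heε : e ≤ 2 * ε) (hk : 2 < k) (hη : 0 < η) (hη1 : η ≤ 1)
    (b : 𝓢(R3, ℂ)) :
    l2norm (weightS (-δ) (besselS s (resolventS (k + η * Complex.I) (besselS s (weightS (-δ) b)))))
      ≤ (140 / e + 2) * k ^ (-(1 - 2 * s)) * l2norm b := by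
  have hk0 : 0 < k := by linarith
  set z : ℂ := k + η * Complex.I with hz
  have him : (z ^ 2).im ≠ 0 := by
    have : (z ^ 2).im = 2 * k * η := by simp [hz, sq]; ring
    rw [this]; positivity
  set f := weightS (-δ) b with hf
  set c : ℝ := (1 + k ^ 2) ^ s with hc
  have hc0 : 0 ≤ c := by positivity
  -- The remainder `m` needs no weights: Plancherel and `symbol_difference_le` bound it. Only the
  -- constant multiple of the resolvent uses the weighted estimate.
  set m := besselS s (resolventS z (besselS s f)) - (c : ℂ) • resolventS z f with hm
  have hNb := l2norm_nonneg b
  have hfb : l2norm f ≤ l2norm b := by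
    have := l2norm_le_mul (f := f) (g := b) (c := 1) (fun x => by
      rw [hf, weightS_apply, norm_mul, Complex.norm_real, Real.norm_of_nonneg (jb_pos _ _).le]
      exact mul_le_mul_of_nonneg_right (jb_le_one (by linarith) x) (norm_nonneg _))
    linarith
  have h1 : l2norm m ≤ 2 * k ^ (2 * s - 2) * l2norm b := by
    rw [← l2norm_fourier m]
    have := l2norm_le_mul (f := 𝓕 m) (g := 𝓕 f) (c := 2 * k ^ (2 * s - 2)) (fun ξ => by
      rw [hm, besselS_resolventS_besselS s him c f ξ, norm_mul]
      exact mul_le_mul_of_nonneg_right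
        (symbol_difference_le hs hs1 hk hη hη1 (by positivity)) (norm_nonneg _))
    rw [l2norm_fourier f] at this
    exact this.trans (by gcongr)
  have h2 : l2norm (weightS (-δ) m) ≤ l2norm m := by
    have := l2norm_le_mul (f := weightS (-δ) m) (g := m) (c := 1) (fun x => by
      rw [weightS_apply, norm_mul, Complex.norm_real, Real.norm_of_nonneg (jb_pos _ _).le]
      exact mul_le_mul_of_nonneg_right (jb_le_one (by linarith) x) (norm_nonneg _))
    linarith
  -- `69² = 4761` exceeds the constant `4720`. The condition `e ≤ 2ε` makes the weights
  -- `⟨x⟩^(∓(1+e))` comparable with `⟨x⟩^(∓2δ)` in the required directions.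
  have h3 : l2norm (weightS (-δ) (resolventS z f)) ≤ 69 / e / k * l2norm b := by
    apply abs_le_of_sq_le_sq' _ (by positivity) |>.2
    rw [l2norm_weightS_sq]
    have a := helmholtz_weighted_estimate he he' hk hη hη1 (resolventS z f)
    rw [← hz, helmholtz_resolventS him] at a
    have b1 : sqInt (jb (2 * -δ)) (resolventS z f) ≤ sqInt (jb (-1 - e)) (resolventS z f) :=
      sqInt_mono (by fun_prop) (by fun_prop) (fun x => jb_mono (by linarith) x) _
    have b2 : sqInt (jb (1 + e)) f ≤ l2norm b ^ 2 := by
      rw [l2norm_sq]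
      unfold sqInt
      refine integral_mono (integrable_sq (by fun_prop) f) ?_ fun x => ?_
      · simpa [jb_zero] using integrable_sq (jb_hasTemperateGrowth 0) b
      · simp only
        rw [hf, weightS_apply, norm_mul, mul_pow, Complex.norm_real,
          Real.norm_of_nonneg (jb_pos _ _).le, ← mul_assoc, sq (jb (-δ) x), ← jb_add, ← jb_add]
        exact mul_le_of_le_one_left (by positivity) (jb_le_one (by linarith) x)
    have b3 : k ^ 2 * sqInt (jb (2 * -δ)) (resolventS z f) ≤ 4720 / e ^ 2 * l2norm b ^ 2 :=
      (mul_le_mul_of_nonneg_left b1 (by positivity)).trans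
        (a.trans (mul_le_mul_of_nonneg_left b2 (by positivity)))
    have b4 : sqInt (jb (2 * -δ)) (resolventS z f) ≤ 4720 / e ^ 2 * l2norm b ^ 2 / k ^ 2 := by
      rw [le_div_iff₀ (by positivity)]; linarith
    refine b4.trans ?_
    have : (69 / e / k * l2norm b) ^ 2 = 4761 / e ^ 2 * l2norm b ^ 2 / k ^ 2 := by
      ring
    rw [this]
    gcongr
    norm_num
  have hsplit : besselS s (resolventS z (besselS s f)) = (c : ℂ) • resolventS z f + m := by
    rw [hm]; abel
  have h4 : l2norm ((c : ℂ) • weightS (-δ) (resolventS z f))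
      ≤ c * l2norm (weightS (-δ) (resolventS z f)) :=
    l2norm_le_mul fun x => by
      rw [_root_.smul_apply, norm_smul, Complex.norm_real, Real.norm_of_nonneg hc0]
  have hc2 : c ≤ 2 * k ^ (2 * s) := by
    have e1 : k ^ (2 * s) = (k ^ 2) ^ s := by
      rw [← Real.rpow_natCast k 2, ← Real.rpow_mul hk0.le]; norm_num
    rw [hc, e1]
    calc (1 + k ^ 2) ^ s ≤ (2 * k ^ 2) ^ s :=
          Real.rpow_le_rpow (by positivity) (by nlinarith) hs
      _ = 2 ^ s * (k ^ 2) ^ s := Real.mul_rpow (by norm_num) (by positivity)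
      _ ≤ 2 * (k ^ 2) ^ s := by
          gcongr
          simpa using Real.rpow_le_rpow_of_exponent_le (by norm_num : (1 : ℝ) ≤ 2) hs1
  have e2 : k ^ (2 * s) / k = k ^ (-(1 - 2 * s)) := by
    rw [← Real.rpow_sub_one hk0.ne']; congr 1; ring
  have e3 : k ^ (2 * s - 2) ≤ k ^ (-(1 - 2 * s)) :=
    Real.rpow_le_rpow_of_exponent_le (by linarith) (by linarith)
  rw [hsplit, map_add, map_smul]
  calc _ ≤ _ := l2norm_add_le _ _
    _ ≤ c * (69 / e / k * l2norm b) + 2 * k ^ (2 * s - 2) * l2norm b :=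
        add_le_add (h4.trans (mul_le_mul_of_nonneg_left h3 hc0)) (h2.trans h1)
    _ ≤ 2 * k ^ (2 * s) * (69 / e / k * l2norm b) + 2 * k ^ (-(1 - 2 * s)) * l2norm b := by gcongr
    _ = (138 / e + 2) * k ^ (-(1 - 2 * s)) * l2norm b := by rw [← e2]; field_simp; ring
    _ ≤ _ := by gcongr; norm_num

/-! ### Weighted Sobolev spaces as copies of `L²`, and density of Schwartz functions. -/

theorem weightS_weightS (δ : ℝ) (f : 𝓢(R3, ℂ)) : weightS (-δ) (weightS δ f) = f := by
  ext x
  rw [weightS_apply, weightS_apply, ← mul_assoc, ← Complex.ofReal_mul, mul_comm (jb (-δ) x),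
    jb_mul_neg]; simp

theorem besselS_besselS (s : ℝ) (f : 𝓢(R3, ℂ)) : besselS s (besselS (-s) f) = f := by
  apply schwartz_ext_fourier
  intro ξ
  unfold besselS
  rw [fourier_multiplier_apply (laplaceSymbol_hasTemperateGrowth _),
    fourier_multiplier_apply (laplaceSymbol_hasTemperateGrowth _), ← mul_assoc]
  unfold laplaceSymbol
  rw [bracketPow_mul_neg, one_mul]

theorem laplaceSymbol_neg (s : ℝ) (ξ : R3) : laplaceSymbol s (-ξ) = laplaceSymbol s ξ := by
  unfold laplaceSymbol bracketPow; simp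

/-- The multiplier is its own transpose for the bilinear pairing because its symbol is even. -/
theorem fracBessel_apply (s : ℝ) (u : 𝓢'(R3, ℂ)) (χ : 𝓢(R3, ℂ)) :
    fracBessel s u χ = u (besselS s χ) := by
  unfold fracBessel besselS
  rw [fourierMultiplierCLM_apply_apply, SchwartzMap.fourierMultiplierCLM_apply]
  congr 1
  ext x
  have h := laplaceSymbol_hasTemperateGrowth s
  rw [SchwartzMap.fourierInv_coe, SchwartzMap.fourier_coe, Real.fourierInv_eq_fourier_comp_neg]
  refine congrArg (fun F : R3 → ℂ => 𝓕 F x) (funext fun ξ => ?_)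
  rw [SchwartzMap.smulLeftCLM_apply_apply h, SchwartzMap.smulLeftCLM_apply_apply h,
    laplaceSymbol_neg, SchwartzMap.fourierInv_coe, Real.fourierInv_eq_fourier_neg,
    SchwartzMap.fourier_coe]

theorem smulLeftCLM_bracketPow_apply (δ : ℝ) (u : 𝓢'(R3, ℂ)) (χ : 𝓢(R3, ℂ)) :
    smulLeftCLM ℂ (bracketPow δ) u χ = u (weightS δ χ) := rfl

theorem weightedBessel_apply (s δ : ℝ) (u : 𝓢'(R3, ℂ)) (χ : 𝓢(R3, ℂ)) :
    weightedBessel s δ u χ = u (besselS s (weightS δ χ)) := by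
  unfold weightedBessel
  rw [ContinuousLinearMap.comp_apply, smulLeftCLM_bracketPow_apply, fracBessel_apply]

namespace WeightedSobolev

variable {s δ : ℝ}

/-- This moves the inverse operators onto the test function, so every pairing with `H^s_δ` becomes
an `L²` pairing with the representative. -/
theorem toDistribution_apply (φ : WeightedSobolev s δ) (χ : 𝓢(R3, ℂ)) :
    φ.toDistribution χ = ∫ x, weightS (-δ) (besselS (-s) χ) x * φ.repr x := by
  have h := congrArg (fun u : 𝓢'(R3, ℂ) => u (weightS (-δ) (besselS (-s) χ))) φ.repr_spec
  simp only [weightedBessel_apply, Lp.toTemperedDistribution_apply, smul_eq_mul] at h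
  have h2 := weightS_weightS (-δ) (besselS (-s) χ)
  rw [neg_neg] at h2
  rw [h2, besselS_besselS] at h
  exact h

/-- The element of `H^s_δ` represented by a given `L²` function. -/
def ofRepr (s δ : ℝ) (g : Lp ℂ 2 (volume : Measure R3)) : WeightedSobolev s δ where
  toDistribution := fracBessel (-s) (smulLeftCLM ℂ (bracketPow (-δ)) (g : 𝓢'(R3, ℂ)))
  mem := ⟨g, by
    ext χ
    rw [weightedBessel_apply, fracBessel_apply, smulLeftCLM_bracketPow_apply]
    have h1 := besselS_besselS (-s) (weightS δ χ)
    rw [neg_neg] at h1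
    rw [h1, weightS_weightS]⟩

theorem repr_ofRepr (g : Lp ℂ 2 (volume : Measure R3)) : (ofRepr s δ g).repr = g := by
  apply lp_toDistribution_injective
  simp only [Lp.toTemperedDistributionCLM_apply]
  rw [← repr_spec]
  ext χ
  rw [weightedBessel_apply]
  unfold ofRepr
  rw [fracBessel_apply, smulLeftCLM_bracketPow_apply]
  have h1 := besselS_besselS (-s) (weightS δ χ)
  rw [neg_neg] at h1
  rw [h1, weightS_weightS]

theorem repr_add (φ ψ : WeightedSobolev s δ) : (φ + ψ).repr = φ.repr + ψ.repr :=
  map_add reprHom φ ψ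

theorem repr_smul (c : ℂ) (φ : WeightedSobolev s δ) : (c • φ).repr = c • φ.repr :=
  map_smul reprHom c φ

theorem ext_repr {φ ψ : WeightedSobolev s δ} (h : φ.repr = ψ.repr) : φ = ψ := reprHom_injective h

/-- The element of `H^s_δ` given by a Schwartz function. -/
theorem isGivenBy_ofRepr_schwartz (b : 𝓢(R3, ℂ)) :
    IsGivenBy (ofRepr s δ (b.toLp 2 (volume : Measure R3))).toDistribution
      (besselS (-s) (weightS (-δ) b)) := by
  intro ψ
  constructor
  · have := integrable_weight_mul_mul (jb_hasTemperateGrowth 0) ψ (besselS (-s) (weightS (-δ) b))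
    simpa [jb_zero] using this
  · have e : (ofRepr s δ (b.toLp 2 (volume : Measure R3))).toDistribution
        = (((besselS (-s) (weightS (-δ) b)) : 𝓢(R3, ℂ)) : 𝓢'(R3, ℂ)) := by
      unfold ofRepr besselS fracBessel
      simp only
      rw [Lp.toTemperedDistribution_toLp_eq,
        ← fourierMultiplierCLM_toTemperedDistributionCLM_eq (laplaceSymbol_hasTemperateGrowth _)]
      congr 1
      ext χ
      rw [smulLeftCLM_bracketPow_apply]
      simp only [SchwartzMap.toTemperedDistributionCLM_apply_apply, weightS_apply, smul_eq_mul]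
      congr 1; ext x; ring
    rw [e]
    exact SchwartzMap.toTemperedDistributionCLM_apply_apply (μ := volume) _ _

theorem dense_schwartz : DenseRange
    (fun b : 𝓢(R3, ℂ) => ofRepr s δ (b.toLp 2 (volume : Measure R3))) := by
  intro φ
  rw [Metric.mem_closure_range_iff]
  intro r hr
  have hd : DenseRange (SchwartzMap.toLpCLM ℝ ℂ 2 (volume : Measure R3)) :=
    SchwartzMap.denseRange_toLpCLM (by norm_num)
  have := Metric.mem_closure_range_iff.1 (hd φ.repr) r hr
  obtain ⟨b, hb⟩ := this
  refine ⟨b, ?_⟩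
  have h1 : dist φ (ofRepr s δ (b.toLp 2 (volume : Measure R3)))
      = dist φ.repr (ofRepr s δ (b.toLp 2 (volume : Measure R3))).repr := rfl
  rw [h1, repr_ofRepr]
  exact hb

end WeightedSobolev

/-! ### Duality in `L²` and weak limits of operators. -/

/-- Riesz representation for functionals on Schwartz functions that are bounded in `L²`. -/
theorem exists_lp_of_bounded (l : 𝓢(R3, ℂ) →ₗ[ℂ] ℂ) {M : ℝ} (hM : 0 ≤ M)
    (hl : ∀ b, ‖l b‖ ≤ M * l2norm b) :
    ∃ G : Lp ℂ 2 (volume : Measure R3), ‖G‖ ≤ M ∧ ∀ b : 𝓢(R3, ℂ), ∫ x, b x * G x = l b := by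
  -- The Riesz pairing conjugates one argument while `∫ b G` is bilinear; conjugating both the
  -- argument and the value of `l` reconciles them and keeps `m` linear.
  let m : 𝓢(R3, ℂ) →ₗ[ℂ] ℂ :=
    { toFun := fun b => (starRingEnd ℂ) (l (conjS b))
      map_add' := fun a b => by
        have : conjS (a + b) = conjS a + conjS b := by ext x; simp
        rw [this, map_add, map_add]
      map_smul' := fun c b => by
        have : conjS (c • b) = (starRingEnd ℂ) c • conjS b := by ext x; simp
        rw [this, map_smul]; simp }
  have hm : ∀ b, ‖m b‖ ≤ M * ‖(SchwartzMap.toLpCLM ℂ ℂ 2 (volume : Measure R3)).toLinearMap b‖ := by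
    intro b
    have h1 : ‖m b‖ = ‖l (conjS b)‖ := RCLike.norm_conj _
    rw [h1]
    refine (hl _).trans (mul_le_mul_of_nonneg_left ?_ hM)
    have := l2norm_le_mul (f := conjS b) (g := b) (c := 1) (fun x => by simp)
    rw [one_mul] at this
    exact this
  have hd : DenseRange (SchwartzMap.toLpCLM ℂ ℂ 2 (volume : Measure R3)).toLinearMap :=
    SchwartzMap.denseRange_toLpCLM (F := ℂ) (p := 2) (μ := (volume : Measure R3)) (by norm_num)
  set Λ := m.extendOfNorm (SchwartzMap.toLpCLM ℂ ℂ 2 (volume : Measure R3)).toLinearMap with hΛ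
  have hΛ1 : ∀ b : 𝓢(R3, ℂ), Λ (b.toLp 2 (volume : Measure R3)) = m b := fun b =>
    LinearMap.extendOfNorm_eq hd ⟨M, hm⟩ b
  have hΛ2 : ‖Λ‖ ≤ M := ContinuousLinearMap.opNorm_le_bound _ hM fun x =>
    LinearMap.norm_extendOfNorm_apply_le hd M hm x
  set G := (InnerProductSpace.toDual ℂ (Lp ℂ 2 (volume : Measure R3))).symm Λ with hG
  refine ⟨G, by rw [hG, LinearIsometryEquiv.norm_map]; exact hΛ2, fun b => ?_⟩
  have h1 : inner ℂ G ((conjS b).toLp 2 (volume : Measure R3)) = m (conjS b) := by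
    rw [hG, InnerProductSpace.toDual_symm_apply, hΛ1]
  have h2 : (starRingEnd ℂ) (m (conjS b)) = l b := by
    change (starRingEnd ℂ) ((starRingEnd ℂ) (l (conjS (conjS b)))) = l b
    rw [conjS_conjS, Complex.conj_conj]
  rw [← h2, ← h1, inner_conj_symm, L2.inner_def]
  refine integral_congr_ae ?_
  filter_upwards [(conjS b).coeFn_toLp 2 (volume : Measure R3)] with x hx
  rw [hx]
  simp [mul_comm]

theorem lp_apply (g : Lp ℂ 2 (volume : Measure R3)) (b : 𝓢(R3, ℂ)) :
    (g : 𝓢'(R3, ℂ)) b = ∫ x, b x * g x := by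
  rw [Lp.toTemperedDistribution_apply]
  rfl

theorem norm_lp_apply_le (g : Lp ℂ 2 (volume : Measure R3)) (b : 𝓢(R3, ℂ)) :
    ‖(g : 𝓢'(R3, ℂ)) b‖ ≤ ‖g‖ * l2norm b := by
  have h : (g : 𝓢'(R3, ℂ)) b = inner ℂ ((conjS b).toLp 2 (volume : Measure R3)) g := by
    rw [lp_apply, L2.inner_def]
    refine integral_congr_ae ?_
    filter_upwards [(conjS b).coeFn_toLp 2 (volume : Measure R3)] with x hx
    rw [hx]
    simp [mul_comm]
  rw [h, mul_comm]
  refine (norm_inner_le_norm _ _).trans (mul_le_mul_of_nonneg_right ?_ (norm_nonneg _))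
  have := l2norm_le_mul (f := conjS b) (g := b) (c := 1) (fun x => by simp)
  rwa [one_mul] at this

theorem lp_add_apply (g h : Lp ℂ 2 (volume : Measure R3)) (b : 𝓢(R3, ℂ)) :
    ((g + h : Lp ℂ 2 (volume : Measure R3)) : 𝓢'(R3, ℂ)) b
      = (g : 𝓢'(R3, ℂ)) b + (h : 𝓢'(R3, ℂ)) b := by
  have := map_add (Lp.toTemperedDistributionCLM ℂ (volume : Measure R3) 2) g h
  exact congrArg (fun u : 𝓢'(R3, ℂ) => u b) this

theorem lp_smul_apply (c : ℂ) (g : Lp ℂ 2 (volume : Measure R3)) (b : 𝓢(R3, ℂ)) :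
    ((c • g : Lp ℂ 2 (volume : Measure R3)) : 𝓢'(R3, ℂ)) b = c * (g : 𝓢'(R3, ℂ)) b := by
  have := map_smul (Lp.toTemperedDistributionCLM ℂ (volume : Measure R3) 2) c g
  exact congrArg (fun u : 𝓢'(R3, ℂ) => u b) this

theorem lp_ext {g h : Lp ℂ 2 (volume : Measure R3)}
    (H : ∀ b : 𝓢(R3, ℂ), (g : 𝓢'(R3, ℂ)) b = (h : 𝓢'(R3, ℂ)) b) : g = h := by
  apply WeightedSobolev.lp_toDistribution_injective
  ext b
  exact H b

/-- A sequence of operators on Schwartz functions that is uniformly bounded in `L²` has a weak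
limit point, as an operator acting on `L²` by duality. -/
theorem exists_weak_limit_operator (A : ℕ → 𝓢(R3, ℂ) →L[ℂ] 𝓢(R3, ℂ)) {K : ℝ} (hK : 0 ≤ K)
    (hA : ∀ n b, l2norm (A n b) ≤ K * l2norm b) :
    ∃ S : Lp ℂ 2 (volume : Measure R3) →ₗ[ℂ] Lp ℂ 2 (volume : Measure R3),
      (∀ g, ‖S g‖ ≤ K * ‖g‖) ∧ ∀ (g : Lp ℂ 2 (volume : Measure R3)) (b : 𝓢(R3, ℂ)) (c : ℂ),
        Tendsto (fun n => (g : 𝓢'(R3, ℂ)) (A n b)) atTop (𝓝 c) → (S g : 𝓢'(R3, ℂ)) b = c := by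
  -- Limits along an ultrafilter exist for every bounded sequence and are linear, so no subsequence
  -- depending on `g` and `b` is needed; an ordinary limit, when it exists, is the same number.
  have hU : (hyperfilter ℕ : Filter ℕ) ≤ atTop := Nat.hyperfilter_le_atTop
  have hbd : ∀ (g : Lp ℂ 2 (volume : Measure R3)) b n,
      ‖(g : 𝓢'(R3, ℂ)) (A n b)‖ ≤ K * ‖g‖ * l2norm b := fun g b n => by
    refine (norm_lp_apply_le g _).trans ?_
    calc ‖g‖ * l2norm (A n b) ≤ ‖g‖ * (K * l2norm b) :=
          mul_le_mul_of_nonneg_left (hA n b) (norm_nonneg _)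
      _ = K * ‖g‖ * l2norm b := by ring
  have hlim : ∀ (g : Lp ℂ 2 (volume : Measure R3)) b, ∃ c : ℂ, ‖c‖ ≤ K * ‖g‖ * l2norm b ∧
      Tendsto (fun n => (g : 𝓢'(R3, ℂ)) (A n b)) (hyperfilter ℕ) (𝓝 c) := fun g b => by
    obtain ⟨c, hc, hc'⟩ := (isCompact_closedBall (0 : ℂ) (K * ‖g‖ * l2norm b)).ultrafilter_le_nhds
      ((hyperfilter ℕ).map (fun n => (g : 𝓢'(R3, ℂ)) (A n b))) 
      (tendsto_principal.2 (Eventually.of_forall fun n => by simpa using hbd g b n))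
    exact ⟨c, by simpa using hc, hc'⟩
  choose L hL1 hL2 using hlim
  have hl : ∀ g : Lp ℂ 2 (volume : Measure R3), ∃ G : Lp ℂ 2 (volume : Measure R3),
      ‖G‖ ≤ K * ‖g‖ ∧ ∀ b : 𝓢(R3, ℂ), (G : 𝓢'(R3, ℂ)) b = L g b := fun g => by
    let l : 𝓢(R3, ℂ) →ₗ[ℂ] ℂ :=
      { toFun := L g
        map_add' := fun a b => tendsto_nhds_unique (hL2 g (a + b)) <| by
          simpa only [map_add] using (hL2 g a).add (hL2 g b)
        map_smul' := fun c b => tendsto_nhds_unique (hL2 g (c • b)) <| by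
          simpa only [map_smul, smul_eq_mul, RingHom.id_apply] using (hL2 g b).const_mul c }
    obtain ⟨G, hG, hG'⟩ := exists_lp_of_bounded l (by positivity) (hL1 g)
    exact ⟨G, hG, fun b => (lp_apply G b).trans (hG' b)⟩
  choose S hS1 hS2 using hl
  refine ⟨{ toFun := S, map_add' := fun g h => ?_, map_smul' := fun c g => ?_ }, hS1,
    fun g b c hc => ?_⟩
  · refine lp_ext fun b => ?_
    rw [lp_add_apply, hS2, hS2, hS2]
    refine tendsto_nhds_unique (hL2 (g + h) b) ?_
    simpa only [lp_add_apply] using (hL2 g b).add (hL2 h b)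
  · refine lp_ext fun b => ?_
    rw [lp_smul_apply, hS2, hS2]
    refine tendsto_nhds_unique (hL2 (c • g) b) ?_
    simpa only [lp_smul_apply, RingHom.id_apply] using (hL2 g b).const_mul c
  · exact (hS2 g b).trans (tendsto_nhds_unique (hL2 g b) (hc.mono_left hU))

/-! ### The limiting absorption operator. -/

/-- The spectral parameters `k + i/(n+1)` approaching the positive real axis. -/
def spectralParam (k : ℝ) (n : ℕ) : ℂ := k + ((1 / (n + 1 : ℝ) : ℝ) : ℂ) * Complex.I

/-- The limiting absorption operator. -/
theorem exists_limiting_absorption {s ε e k : ℝ} (hs : 0 ≤ s) (hs1 : s ≤ 1) (he : 0 < e)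
    (he1 : e ≤ 1 / 5) (he2 : e ≤ 2 * ε) (hk : 2 < k) :
    ∃ T : WeightedSobolev (-s) (1 / 2 + ε) →L[ℂ] WeightedSobolev s (-(1 / 2 + ε)),
      (∀ φ, ‖T φ‖ ≤ (140 / e + 2) * k ^ (-(1 - 2 * s)) * ‖φ‖) ∧
      ∀ φ χ c, Tendsto (fun n => φ.toDistribution (resolventS (spectralParam k n) χ)) atTop (𝓝 c) →
        (T φ).toDistribution χ = c := by
  set δ := 1 / 2 + ε with hδ
  set K := (140 / e + 2) * k ^ (-(1 - 2 * s)) with hKdef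
  have hK : 0 ≤ K := by
    have : 0 < k := by linarith
    positivity
  -- The resolvent conjugated to `L²`: its inner and outer factors are the passages between
  -- `H^{-s}_δ`, `H^s_{-δ}` and their representatives. Acting on the test function rather than on
  -- `φ`, it defines the limit operator by duality.
  let A : ℕ → 𝓢(R3, ℂ) →L[ℂ] 𝓢(R3, ℂ) := fun n =>
    weightS (-δ) ∘L besselS s ∘L resolventS (spectralParam k n) ∘L besselS s ∘L weightS (-δ)
  have hA' : ∀ n b, A n b = weightS (-δ) (besselS s (resolventS (spectralParam k n)
      (besselS s (weightS (-δ) b)))) := fun n b => rfl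
  have hA : ∀ n b, l2norm (A n b) ≤ K * l2norm b := fun n b => by
    have h1 : (1 / (n + 1 : ℝ)) ≤ 1 := by
      rw [div_le_one (by positivity)]; linarith [(n.cast_nonneg : (0 : ℝ) ≤ n)]
    have h2 := l2norm_sandwich_le (η := 1 / (n + 1 : ℝ)) hs hs1 hδ he he1 he2 hk
      (by positivity) h1 b
    rw [hA']
    exact h2
  clear_value A
  obtain ⟨S, hS1, hS2⟩ := exists_weak_limit_operator A hK hA
  let T₀ : WeightedSobolev (-s) δ →ₗ[ℂ] WeightedSobolev s (-δ) :=
    { toFun := fun φ => .ofRepr s (-δ) (S φ.repr)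
      map_add' := fun φ ψ => WeightedSobolev.ext_repr <| by
        simp only [WeightedSobolev.repr_add, WeightedSobolev.repr_ofRepr, map_add]
      map_smul' := fun c φ => WeightedSobolev.ext_repr <| by
        simp only [WeightedSobolev.repr_smul, WeightedSobolev.repr_ofRepr, map_smul,
          RingHom.id_apply] }
  have hT₀ : ∀ φ, ‖T₀ φ‖ ≤ K * ‖φ‖ := fun φ => by
    rw [WeightedSobolev.norm_def, WeightedSobolev.norm_def]
    change ‖(WeightedSobolev.ofRepr s (-δ) (S φ.repr)).repr‖ ≤ _
    rw [WeightedSobolev.repr_ofRepr]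
    exact hS1 _
  refine ⟨T₀.mkContinuous K hT₀, hT₀, fun φ χ c hc => ?_⟩
  change (WeightedSobolev.ofRepr s (-δ) (S φ.repr)).toDistribution χ = c
  rw [WeightedSobolev.toDistribution_apply, WeightedSobolev.repr_ofRepr, neg_neg, ← lp_apply]
  refine hS2 _ _ c (hc.congr fun n => ?_)
  rw [hA', weightS_weightS, besselS_besselS, WeightedSobolev.toDistribution_apply, lp_apply,
    neg_neg]

/-! ### Agreement of the limit operator with the outgoing integral operator. -/

theorem outgoingKernel_eq_regG (k : ℝ) (x y : R3) : outgoingKernel k x y = regG k ‖x - y‖ := rfl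

theorem measurable_regG_norm_sub (z : ℂ) : Measurable (fun p : R3 × R3 => regG z ‖p.1 - p.2‖) := by
  unfold regG
  fun_prop

theorem measurable_regG (z : ℂ) : Measurable (regG z) := by
  unfold regG
  fun_prop

theorem norm_outgoingKernel (k : ℝ) (x y : R3) :
    ‖outgoingKernel k x y‖ = (4 * Real.pi)⁻¹ * ‖x - y‖⁻¹ := by
  have h1 : Complex.I * k * ‖x - y‖ = ((k * ‖x - y‖ : ℝ) : ℂ) * Complex.I := by push_cast; ring
  unfold outgoingKernel
  rw [norm_div, h1, Complex.norm_exp_ofReal_mul_I, norm_mul, norm_mul, Complex.norm_real,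
    Complex.norm_real, norm_norm, Real.norm_of_nonneg Real.pi_pos.le]
  simp [mul_comm]

theorem measurable_outgoingKernel (k : ℝ) (x : R3) : Measurable (outgoingKernel k x) := by
  unfold outgoingKernel
  fun_prop

theorem ae_ne_point (x : R3) : ∀ᵐ y : R3, y ≠ x := by
  simp [ae_iff]

/-- A function whose potential converges at some point is integrable against `⟨y⟩⁻¹`. -/
theorem ResolventIntegrable.integrable_jb_mul {k : ℝ} {f : R3 → ℂ} (h : ResolventIntegrable k f) :
    AEStronglyMeasurable f ∧ Integrable (fun y => jb (-1) y * ‖f y‖) := by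
  -- A single point suffices: the modulus of the kernel never vanishes for `y ≠ x` and is bounded
  -- below by a multiple of `⟨y⟩⁻¹`. Dividing by the kernel also recovers measurability of `f`.
  obtain ⟨x, hx⟩ := h.exists
  have hk0 : ∀ᵐ y : R3, outgoingKernel k x y ≠ 0 := by
    filter_upwards [ae_ne_point x] with y hy
    rw [← norm_ne_zero_iff, norm_outgoingKernel]
    have : ‖x - y‖ ≠ 0 := by rw [norm_ne_zero_iff, sub_ne_zero]; exact hy.symm
    have := Real.pi_pos
    positivity
  have hf : AEStronglyMeasurable f := by
    refine ((measurable_outgoingKernel k x).inv.aestronglyMeasurable.mul hx.1).congr ?_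
    filter_upwards [hk0] with y hy
    simp only [Pi.mul_apply, Pi.inv_apply]
    rw [← mul_assoc, inv_mul_cancel₀ hy, one_mul]
  refine ⟨hf, (hx.norm.const_mul (4 * Real.pi * (‖x‖ + 1))).mono'
    ((continuous_jb (-1)).aestronglyMeasurable.mul hf.norm) ?_⟩
  filter_upwards [ae_ne_point x] with y hy
  have hxy : 0 < ‖x - y‖ := norm_pos_iff.2 (sub_ne_zero.2 hy.symm)
  rw [norm_mul, norm_mul, norm_norm, norm_outgoingKernel, Real.norm_of_nonneg (jb_pos _ _).le,
    ← mul_assoc]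
  refine mul_le_mul_of_nonneg_right ?_ (norm_nonneg _)
  have h1 : jb 1 y * jb (-1) y = 1 := jb_mul_neg 1 y
  have h2 : ‖x - y‖ ≤ (‖x‖ + 1) * jb 1 y := by
    have a1 : 1 ≤ jb 1 y := by rw [jb_one]; exact Real.one_le_sqrt.2 (by nlinarith [norm_nonneg y])
    have a2 : ‖y‖ ≤ jb 1 y := by rw [jb_one]; exact Real.le_sqrt_of_sq_le (by linarith)
    nlinarith [norm_sub_le x y, norm_nonneg x]
  have h3 : 4 * Real.pi * (‖x‖ + 1) * ((4 * Real.pi)⁻¹ * ‖x - y‖⁻¹) = (‖x‖ + 1) * ‖x - y‖⁻¹ := by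
    have := Real.pi_pos
    field_simp
  rw [h3]
  calc jb (-1) y = jb (-1) y * ‖x - y‖ * ‖x - y‖⁻¹ := by
        rw [mul_assoc, mul_inv_cancel₀ hxy.ne', mul_one]
    _ ≤ jb (-1) y * ((‖x‖ + 1) * jb 1 y) * ‖x - y‖⁻¹ := by
        have := jb_pos (-1) y
        gcongr
    _ = (‖x‖ + 1) * (jb 1 y * jb (-1) y) * ‖x - y‖⁻¹ := by ring
    _ = _ := by rw [h1, mul_one]

theorem integrable_outgoingKernel_mul_schwartz (k : ℝ) (χ : 𝓢(R3, ℂ)) (x : R3) :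
    Integrable (fun y => outgoingKernel k x y * χ y) := by
  obtain ⟨C, -, hC⟩ := exists_integral_inv_norm_mul_schwartz_le χ
  refine (((hC x).1).const_mul (4 * Real.pi)⁻¹).mono'
    ((measurable_outgoingKernel k x).aestronglyMeasurable.mul χ.continuous.aestronglyMeasurable)
    (Eventually.of_forall fun y => ?_)
  rw [norm_mul, norm_outgoingKernel, norm_sub_rev, mul_assoc]

theorem resolventIntegrable_schwartz (k : ℝ) (χ : 𝓢(R3, ℂ)) : ResolventIntegrable k χ :=
  Eventually.of_forall (integrable_outgoingKernel_mul_schwartz k χ)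

/-- The constant does not depend on `z`, which supplies the dominating function for the limit onto
the real axis. -/
theorem exists_norm_potential_le (χ : 𝓢(R3, ℂ)) : ∃ C, ∀ z : ℂ, 0 ≤ z.im → ∀ y : R3,
    ‖∫ x, regG z ‖y - x‖ * χ x‖ ≤ C * jb (-1) y := by
  obtain ⟨C, -, hC⟩ := exists_integral_inv_norm_mul_schwartz_le χ
  refine ⟨(4 * Real.pi)⁻¹ * C, fun z hz y => ?_⟩
  have h1 := norm_integral_le_of_norm_le (f := fun x => regG z ‖y - x‖ * χ x)
    ((hC y).1.const_mul (4 * Real.pi)⁻¹) (Eventually.of_forall fun x => by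
      rw [norm_mul, ← mul_assoc, norm_sub_rev x y]
      exact mul_le_mul_of_nonneg_right (norm_regG_le hz (norm_nonneg _)) (norm_nonneg _))
  refine h1.trans ?_
  rw [integral_const_mul, mul_assoc]
  have := Real.pi_pos
  exact mul_le_mul_of_nonneg_left (hC y).2 (by positivity)

theorem tendsto_spectralParam (k : ℝ) : Tendsto (spectralParam k) atTop (𝓝 (k : ℂ)) := by
  have h : Tendsto (fun n : ℕ => ((1 / (n + 1 : ℝ) : ℝ) : ℂ)) atTop (𝓝 ((0 : ℝ) : ℂ)) :=
    (Complex.continuous_ofReal.tendsto 0).comp tendsto_one_div_add_atTop_nhds_zero_nat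
  have h2 := (h.mul_const Complex.I).const_add (k : ℂ)
  rwa [Complex.ofReal_zero, zero_mul, add_zero] at h2

theorem spectralParam_im_nonneg (k : ℝ) (n : ℕ) : 0 ≤ (spectralParam k n).im := by
  have : (spectralParam k n).im = 1 / (n + 1 : ℝ) := by
    unfold spectralParam
    rw [Complex.add_im, Complex.ofReal_im, Complex.im_ofReal_mul, Complex.I_im]
    ring
  rw [this]; positivity

theorem tendsto_resolventS {k : ℝ} (hk : 0 < k) (χ : 𝓢(R3, ℂ)) (y : R3) :
    Tendsto (fun n => resolventS (spectralParam k n) χ y) atTop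
      (𝓝 (resolventIntegral k χ y)) := by
  obtain ⟨C, -, hC⟩ := exists_integral_inv_norm_mul_schwartz_le χ
  have h : ∀ n, resolventS (spectralParam k n) χ y
      = ∫ x, regG (spectralParam k n) ‖y - x‖ * χ x := fun n =>
    resolventS_apply hk (by positivity) χ y
  simp only [h]
  refine tendsto_integral_of_dominated_convergence _
    (fun n => (((measurable_regG _).comp (by fun_prop)).aestronglyMeasurable.mul
      χ.continuous.aestronglyMeasurable)) ((hC y).1.const_mul (4 * Real.pi)⁻¹)
    (fun n => Eventually.of_forall fun x => ?_) (Eventually.of_forall fun x => ?_)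
  · rw [norm_mul, ← mul_assoc, norm_sub_rev x y]
    exact mul_le_mul_of_nonneg_right
      (norm_regG_le (spectralParam_im_nonneg k n) (norm_nonneg _)) (norm_nonneg _)
  · refine Tendsto.mul_const _ ?_
    have hc : Continuous (fun z : ℂ => regG z ‖y - x‖) := by unfold regG; fun_prop
    exact (hc.tendsto _).comp (tendsto_spectralParam k)

theorem tendsto_integral_resolventS_mul {k : ℝ} (hk : 0 < k) {f : R3 → ℂ}
    (hf : AEStronglyMeasurable f) (hf1 : Integrable (fun y => jb (-1) y * ‖f y‖)) (χ : 𝓢(R3, ℂ)) :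
    Tendsto (fun n => ∫ y, resolventS (spectralParam k n) χ y * f y) atTop
      (𝓝 (∫ y, resolventIntegral k χ y * f y)) := by
  obtain ⟨C, hC⟩ := exists_norm_potential_le χ
  refine tendsto_integral_of_dominated_convergence _
    (fun n => ((resolventS (spectralParam k n) χ).continuous.aestronglyMeasurable.mul hf))
    (hf1.const_mul C) (fun n => Eventually.of_forall fun y => ?_)
    (Eventually.of_forall fun y => (tendsto_resolventS hk χ y).mul_const _)
  rw [norm_mul, ← mul_assoc]
  refine mul_le_mul_of_nonneg_right ?_ (norm_nonneg _)
  have h : resolventS (spectralParam k n) χ y = ∫ x, regG (spectralParam k n) ‖y - x‖ * χ x :=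
    resolventS_apply hk (by positivity) χ y
  rw [h]
  exact hC _ (spectralParam_im_nonneg k n) y

/-- The integral operator `R_k` is symmetric. -/
theorem integral_mul_resolventIntegral (k : ℝ) {f : R3 → ℂ}
    (hf : AEStronglyMeasurable f) (hf1 : Integrable (fun y => jb (-1) y * ‖f y‖)) (χ : 𝓢(R3, ℂ)) :
    Integrable (fun x => χ x * resolventIntegral k f x) ∧
      ∫ x, χ x * resolventIntegral k f x = ∫ y, resolventIntegral k χ y * f y := by
  obtain ⟨C, -, hC⟩ := exists_integral_inv_norm_mul_schwartz_le χ
  set F : R3 × R3 → ℂ := fun p => regG k ‖p.1 - p.2‖ * χ p.2 * f p.1 with hF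
  have hFm : AEStronglyMeasurable F (volume.prod volume) :=
    ((measurable_regG_norm_sub k).aestronglyMeasurable.mul
      (χ.continuous.comp continuous_snd).aestronglyMeasurable).mul hf.comp_fst
  have hnorm : ∀ y x, ‖F (y, x)‖ = (4 * Real.pi)⁻¹ * (‖x - y‖⁻¹ * ‖χ x‖) * ‖f y‖ := fun y x => by
    simp only [hF, norm_mul]
    rw [← outgoingKernel_eq_regG, norm_outgoingKernel, norm_sub_rev, mul_assoc (4 * Real.pi)⁻¹]
  have hFi : Integrable F (volume.prod volume) := by
    rw [integrable_prod_iff hFm]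
    -- Fubini is justified by integrating in `x` first: the potential of `|χ|` is `O(⟨y⟩⁻¹)`, which
    -- is integrable against `|f|`.
    refine ⟨Eventually.of_forall fun y => ?_, ?_⟩
    · exact ((integrable_outgoingKernel_mul_schwartz k χ y).mul_const (f y))
    · refine (hf1.const_mul ((4 * Real.pi)⁻¹ * C)).mono' hFm.norm.integral_prod_right'
        (Eventually.of_forall fun y => ?_)
      rw [Real.norm_of_nonneg (integral_nonneg fun _ => norm_nonneg _)]
      simp only [hnorm]
      rw [integral_mul_const, integral_const_mul, ← mul_assoc, mul_assoc _ C]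
      have := Real.pi_pos
      exact mul_le_mul_of_nonneg_right (mul_le_mul_of_nonneg_left (hC y).2 (by positivity))
        (norm_nonneg _)
  have h1 : ∀ x, χ x * resolventIntegral k f x = ∫ y, F (y, x) := fun x => by
    unfold resolventIntegral
    rw [← integral_const_mul]
    refine integral_congr_ae (Eventually.of_forall fun y => ?_)
    simp only [hF]
    rw [outgoingKernel_eq_regG, norm_sub_rev]
    ring
  have h2 : ∀ y, resolventIntegral k χ y * f y = ∫ x, F (y, x) := fun y => by
    unfold resolventIntegral
    rw [← integral_mul_const]
    rfl
  simp only [h1, h2]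
  exact ⟨hFi.integral_prod_right, (integral_integral_swap (f := fun y x => F (y, x)) hFi).symm⟩

theorem exists_resolvent_extension {s ε : ℝ} (hs : 0 ≤ s) (hs1 : s ≤ 1) (hε : 0 < ε) :
    ∃ C : ℝ, 0 < C ∧ ∀ k : ℝ, 2 < k →
      ∃ R : WeightedSobolev (-s) (1 / 2 + ε) →L[ℂ] WeightedSobolev s (-(1 / 2 + ε)),
        ExtendsResolvent k R ∧
        (∀ R' : WeightedSobolev (-s) (1 / 2 + ε) →L[ℂ] WeightedSobolev s (-(1 / 2 + ε)),
          ExtendsResolvent k R' → R' = R) ∧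
        ∀ φ : WeightedSobolev (-s) (1 / 2 + ε), ‖R φ‖ ≤ C * k ^ (-(1 - 2 * s)) * ‖φ‖ := by
  -- The exponent loss `e` must be at most `2ε` to fit the given weights and at most `1/5` for the
  -- sign conditions on the multiplier field; the constant then depends on `ε` only.
  have he : 0 < min (2 * ε) (1 / 5) := by positivity
  refine ⟨140 / min (2 * ε) (1 / 5) + 2, by positivity, fun k hk => ?_⟩
  obtain ⟨R, hR1, hR2⟩ := exists_limiting_absorption hs hs1 he (min_le_right _ _)
    (min_le_left _ _) hk
  have hk0 : 0 < k := by linarith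
  have hR : ExtendsResolvent k R := by
    intro φ f hφ hf χ
    obtain ⟨hfm, hf1⟩ := hf.integrable_jb_mul
    obtain ⟨h1, h2⟩ := integral_mul_resolventIntegral k hfm hf1 χ
    refine ⟨h1, h2 ▸ hR2 φ χ _ ?_⟩
    simp only [fun n => (hφ (resolventS (spectralParam k n) χ)).2]
    exact tendsto_integral_resolventS_mul hk0 hfm hf1 χ
  refine ⟨R, hR, fun R' hR' => ?_, hR1⟩
  -- Uniqueness: both operators are continuous, and on the dense set of elements represented by
  -- Schwartz functions both are forced to equal the convergent integral.
  refine DFunLike.coe_injective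
    (WeightedSobolev.dense_schwartz.equalizer R'.continuous R.continuous (funext fun b => ?_))
  apply WeightedSobolev.toDistribution_injective
  ext χ
  have h := WeightedSobolev.isGivenBy_ofRepr_schwartz (s := -s) (δ := 1 / 2 + ε) b
  exact ((hR' _ _ h (resolventIntegrable_schwartz k _)) χ).2.trans
    ((hR _ _ h (resolventIntegrable_schwartz k _)) χ).2.symm

end

/-- For `0 < s < 1/2` and `ε > 0` there is a constant `C`, depending on `s` and `ε` only, such that
for every `k > 2` the integral operator `R_k` has exactly one bounded extension
`H^{-s}_{1/2+ε} → H^s_{-1/2-ε}`, and `‖R_k φ‖ ≤ C k^{-(1-2s)} ‖φ‖` for all `φ ∈ H^{-s}_{1/2+ε}`. -/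
theorem lemma2p3 (s ε : ℝ) (hs : 0 < s) (hs' : s < 1 / 2) (hε : 0 < ε) :
    ∃ C : ℝ, 0 < C ∧ ∀ k : ℝ, 2 < k →
      ∃ R : WeightedSobolev (-s) (1 / 2 + ε) →L[ℂ] WeightedSobolev s (-1 / 2 - ε),
        ExtendsResolvent k R ∧
        (∀ R' : WeightedSobolev (-s) (1 / 2 + ε) →L[ℂ] WeightedSobolev s (-1 / 2 - ε),
          ExtendsResolvent k R' → R' = R) ∧
        ∀ φ : WeightedSobolev (-s) (1 / 2 + ε), ‖R φ‖ ≤ C * k ^ (-(1 - 2 * s)) * ‖φ‖ := by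
  have h : -1 / 2 - ε = -(1 / 2 + ε) := by ring
  rw [h]
  exact exists_resolvent_extension hs.le (by linarith) hε
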